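/- Let $q$ be an odd prime power, let $\mathbb{K}$ be the algebraic closure of $\mathbb{F}_q$, and let $\beta\in\mathbb{F}_{q^4}\setminus\{0,1,-1\}$ satisfy $\beta^{2q}=\beta^2$. For $\eta\in\mathbb{F}_{q^4}$ let $\mathcal{V}\subset\mathbb{P}^7(\mathbb{K})$ be the projective variety with equations \[ \begin{cases} W_0^2 = \eta Y_0^2 + \eta^{q} Y_1^2 - 2\beta\eta^{\frac{q+1}{2}}Y_0 Y_1,\\ W_1^2 = \eta^q Y_1^2 + \eta^{q^2} Y_2^2 - 2\beta^q\eta^{\frac{q^2+q}{2}}Y_1 Y_2,\\ W_2^2 = \eta^{q^2} Y_2^2 + \eta^{q^3} Y_3^2 - 2\beta^{q^2}\eta^{\frac{q^3+q^2}{2}}Y_2 Y_3,\\ (W_0+W_1+W_2)^2 = \eta^{q^3} Y_3^2 + \eta Y_0^2 - 2\beta^{q^3}\eta^{\frac{1+q^3}{2}}Y_3 Y_0 \end{cases} \] in the homogeneous coordinates $(W_0:W_1:W_2:X_3:Y_0:Y_1:Y_2:Y_3)$. Then, for some non-square $\eta$ of $\mathbb{F}_{q^4}$, the variety $\mathcal{V}$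 has exactly three irreducible components (over $\mathbb{K}$) of dimension $3$; exactly two of them have degree $4$, and exactly one of them, $\mathcal{V}'$, has degree $8$. -/

import Mathlib

open MvPolynomial Filter Topology

open scoped LinearAlgebra.Projectivization Nat

namespace ProjVar

variable {K : Type*} [Field K] {σ : Type*}

/-- The polynomial `f` vanishes at the point `P` of projective space: it is zero at all vectors
of the line `P`. -/
def VanishesAt (f : MvPolynomial σ K) (P : ℙ K (σ → K)) : Prop :=
  ∀ v ∈ P.submodule, eval v f = 0

/-- The common zeros in projective space of a set of polynomials. -/
def zeroLocus (s : Set (MvPolynomial σ K)) : Set (ℙ K (σ → K)) :=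
  {P | ∀ f ∈ s, VanishesAt f P}

theorem vanishesAt_iff_rep {f : MvPolynomial σ K} {d : ℕ} (hf : f.IsHomogeneous d)
    (P : ℙ K (σ → K)) : VanishesAt f P ↔ eval P.rep f = 0 := by
  have hsub : P.submodule = Submodule.span K {P.rep} := P.submodule_eq
  constructor
  · intro h
    exact h _ (hsub ▸ Submodule.mem_span_singleton_self _)
  · intro h v hv
    rw [hsub] at hv
    obtain ⟨a, rfl⟩ := Submodule.mem_span_singleton.1 hv
    have key : eval (a • P.rep) f = a ^ d * eval P.rep f := by
      rw [eval_eq, eval_eq, Finset.mul_sum]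
      refine Finset.sum_congr rfl fun m hm => ?_
      have hd : ∑ i ∈ m.support, m i = d := by
        have := hf (mem_support_iff.1 hm)
        rw [Finsupp.weight_apply, Finsupp.sum] at this
        simpa using this
      simp only [Pi.smul_apply, smul_eq_mul, mul_pow, Finset.prod_mul_distrib,
        Finset.prod_pow_eq_pow_sum, hd]
      ring
    rw [key, h, mul_zero]

/-- The Zariski topology on projective space: the closed sets are the zero loci of sets of
homogeneous polynomials. -/
@[reducible]
def zariskiTopology (K : Type*) [Field K] (σ : Type*) : TopologicalSpace (ℙ K (σ → K)) :=
  TopologicalSpace.ofClosed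
    {Z | ∃ s : Set (MvPolynomial σ K), (∀ f ∈ s, ∃ d, f.IsHomogeneous d) ∧ Z = zeroLocus s}
    ⟨{1}, by
      rintro f rfl
      exact ⟨0, isHomogeneous_one σ K⟩, by
      ext P
      simp only [Set.mem_empty_iff_false, false_iff]
      intro h
      simpa using h 1 rfl 0 (Submodule.zero_mem _)⟩
    (by
      intro A hA
      have hA' : ∀ Z ∈ A, ∃ s : Set (MvPolynomial σ K),
          (∀ f ∈ s, ∃ d, f.IsHomogeneous d) ∧ Z = zeroLocus s := fun Z hZA => hA hZA
      choose! s hs hZ using hA'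
      refine ⟨⋃ Z ∈ A, s Z, ?_, ?_⟩
      · intro f hf
        simp only [Set.mem_iUnion] at hf
        obtain ⟨Z, hZA, hf⟩ := hf
        exact hs Z hZA f hf
      · ext P
        simp only [Set.mem_sInter]
        constructor
        · intro h f hf
          simp only [Set.mem_iUnion] at hf
          obtain ⟨Z, hZA, hf⟩ := hf
          have hP := h Z hZA
          rw [hZ Z hZA] at hP
          exact hP f hf
        · intro h Z hZA
          rw [hZ Z hZA]
          intro f hf
          exact h f (by simp only [Set.mem_iUnion]; exact ⟨Z, hZA, hf⟩))
    (by
      rintro _ ⟨s, hs, rfl⟩ _ ⟨t, ht, rfl⟩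
      refine ⟨{h | ∃ f ∈ s, ∃ g ∈ t, h = f * g}, ?_, ?_⟩
      · rintro _ ⟨f, hf, g, hg, rfl⟩
        obtain ⟨d, hd⟩ := hs f hf
        obtain ⟨e, he⟩ := ht g hg
        exact ⟨d + e, hd.mul he⟩
      · ext P
        constructor
        · rintro (h | h) _ ⟨f, hf, g, hg, rfl⟩ v hv
          · rw [map_mul, h f hf v hv, zero_mul]
          · rw [map_mul, h g hg v hv, mul_zero]
        · intro h
          by_contra hn
          rw [Set.mem_union, not_or] at hn
          obtain ⟨h1, h2⟩ := hn
          simp only [zeroLocus, Set.mem_ofPred_eq, not_forall] at h1 h2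
          obtain ⟨f, hf, hfP⟩ := h1
          obtain ⟨g, hg, hgP⟩ := h2
          obtain ⟨d, hd⟩ := hs f hf
          obtain ⟨e, he⟩ := ht g hg
          rw [vanishesAt_iff_rep hd] at hfP
          rw [vanishesAt_iff_rep he] at hgP
          have := (vanishesAt_iff_rep (hd.mul he) P).1 (h _ ⟨f, hf, g, hg, rfl⟩)
          rw [map_mul] at this
          exact (mul_ne_zero hfP hgP) this)

/-- The irreducible components of a subset `V` of projective space: its maximal irreducible
subsets for the Zariski topology. -/
def components (V : Set (ℙ K (σ → K))) : Set (Set (ℙ K (σ → K))) :=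
  {Z | Maximal (fun s => s ⊆ V ∧ @IsIrreducible _ (zariskiTopology K σ) s) Z}

/-- The homogeneous ideal of a subset of projective space (over an infinite field). -/
def vanishingIdeal (Z : Set (ℙ K (σ → K))) : Ideal (MvPolynomial σ K) where
  carrier := {f | ∀ P ∈ Z, VanishesAt f P}
  zero_mem' := fun P _ v _ => by simp
  add_mem' := fun hf hg P hP v hv => by simp [hf P hP v hv, hg P hP v hv]
  smul_mem' := fun c f hf P hP v hv => by simp [hf P hP v hv]

/-- `Z` has dimension `m`: its homogeneous coordinate ring (the coordinate ring of the affine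
cone over `Z`) has Krull dimension `m + 1`. -/
def HasDim (Z : Set (ℙ K (σ → K))) (m : ℕ) : Prop :=
  ringKrullDim (MvPolynomial σ K ⧸ vanishingIdeal Z) = ((m + 1 : ℕ) : WithBot ℕ∞)

/-- The Hilbert function of `Z`: the dimension of the degree `t` part of its homogeneous
coordinate ring. -/
noncomputable def hilbertFunction (Z : Set (ℙ K (σ → K))) (t : ℕ) : ℕ :=
  Module.finrank K
    ((homogeneousSubmodule σ K t).map (Ideal.Quotient.mkₐ K (vanishingIdeal Z)).toLinearMap)

/-- `Z` has degree `d`: with `m = dim Z`, the Hilbert function of `Z` grows like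
`d * t ^ m / m !`, i.e. `d` is `m !` times the leading coefficient of the Hilbert polynomial
of `Z` (see `hasDegree_of_hilbertPolynomial`). -/
def HasDegree (Z : Set (ℙ K (σ → K))) (d : ℕ) : Prop :=
  ∃ m : ℕ, HasDim Z m ∧
    Tendsto (fun t : ℕ => (m ! : ℝ) * hilbertFunction Z t / (t : ℝ) ^ m) atTop (𝓝 (d : ℝ))

theorem hasDegree_of_hilbertPolynomial {Z : Set (ℙ K (σ → K))} {m d : ℕ} (hm : HasDim Z m)
    {P : Polynomial ℝ} (hP : ∀ᶠ t : ℕ in atTop, (hilbertFunction Z t : ℝ) = P.eval (t : ℝ))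
    (hdeg : P.natDegree = m) (hd : (m ! : ℝ) * P.leadingCoeff = d) : HasDegree Z d := by
  refine ⟨m, hm, ?_⟩
  have h1 : Tendsto (fun x : ℝ => P.eval x / (Polynomial.X ^ m : Polynomial ℝ).eval x) atTop
      (𝓝 (P.leadingCoeff / (Polynomial.X ^ m : Polynomial ℝ).leadingCoeff)) := by
    by_cases hP0 : P = 0
    · simp [hP0]
    · refine Polynomial.div_tendsto_atTop_leadingCoeff_div_of_degree_eq _ _ ?_
      rw [Polynomial.degree_X_pow, Polynomial.degree_eq_natDegree hP0, hdeg]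
  have h2 := (h1.comp tendsto_natCast_atTop_atTop).const_mul (m ! : ℝ)
  simp only [Polynomial.leadingCoeff_X_pow, div_one, hd] at h2
  refine h2.congr' ?_
  filter_upwards [hP] with t ht
  simp [ht, mul_div_assoc]

end ProjVar

/-- The variety `V` in `ℙ⁷`, with coordinates `(W₀ : W₁ : W₂ : X₃ : Y₀ : Y₁ : Y₂ : Y₃)` numbered
from `0` to `7`, given by the four quadratic equations
`W₀² = η Y₀² + η^q Y₁² - 2 β η^((q+1)/2) Y₀ Y₁`,
`W₁² = η^q Y₁² + η^(q²) Y₂² - 2 β^q η^((q²+q)/2) Y₁ Y₂`,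
`W₂² = η^(q²) Y₂² + η^(q³) Y₃² - 2 β^(q²) η^((q³+q²)/2) Y₂ Y₃`,
`(W₀ + W₁ + W₂)² = η^(q³) Y₃² + η Y₀² - 2 β^(q³) η^((1+q³)/2) Y₃ Y₀`. -/
def varietyV {K : Type*} [Field K] (q : ℕ) (β η : K) : Set (ℙ K (Fin 8 → K)) :=
  ProjVar.zeroLocus
    {X 0 ^ 2 - (C η * X 4 ^ 2 + C (η ^ q) * X 5 ^ 2
        - C (2 * β * η ^ ((q + 1) / 2)) * X 4 * X 5),
     X 1 ^ 2 - (C (η ^ q) * X 5 ^ 2 + C (η ^ q ^ 2) * X 6 ^ 2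
        - C (2 * β ^ q * η ^ ((q ^ 2 + q) / 2)) * X 5 * X 6),
     X 2 ^ 2 - (C (η ^ q ^ 2) * X 6 ^ 2 + C (η ^ q ^ 3) * X 7 ^ 2
        - C (2 * β ^ q ^ 2 * η ^ ((q ^ 3 + q ^ 2) / 2)) * X 6 * X 7),
     (X 0 + X 1 + X 2) ^ 2 - (C (η ^ q ^ 3) * X 7 ^ 2 + C η * X 4 ^ 2
        - C (2 * β ^ q ^ 3 * η ^ ((1 + q ^ 3) / 2)) * X 7 * X 4)}

/-! Every non-square `η` works. Write `b` for the image of `β` in `K`. From `β^(2q) = β²` follows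
`b^q = ε b` with `ε = ±1`. Take `r` with `r² = η` and put `Z i = τ i * Y i` with `τ = (r, r^q, ε
r^(q²), ε r^(q³))`. All four equations then take the same shape `W² = Z² + Z'² - 2 b Z Z'`, with `W`
one of `W₀, W₁, W₂, W₀ + W₁ + W₂` and `Z, Z'` cyclically consecutive.

Let `c` be the pairwise sums of the `W i` followed by the differences and sums of `Z 0, Z 2` and of
`Z 1, Z 3`. Signed sums of the equations give `c0 c1 = b c3 c4`, `c0 c2 = c3 (c5 - b c6)`, `c1 c2 =
c4 (b c5 - c6)` and one further quadric. Either `c0 = c3 = 0`, or `c1 = c4 = 0`, or the matrix with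
rows `(c0, b c4, c5 - b c6, b c2)` and `(c3, c1, c2, b c5 - c6)` has rank at most one
(`forall_eqs_iff`). The bilinear conditions cut out rational normal scrolls: `S(0,1,1,0)` in each of
the first two cases and `S(1,1,2,0)` in the third. The last `0` is the free coordinate `X₃`. Each
component is the section of its scroll by the remaining quadric.

In the Cox ring of the scroll this quadric becomes a prime `g` (Eisenstein). By the Nullstellensatz
the coordinate ring of the section embeds in the Cox ring modulo `g`, so the section is irreducible.
Its degree `t + 2` part has dimension `dim (scrollPart (t + 2)) - dim (scrollPart t)`. Since `dim
(scrollPart t)` grows like `(a 0 + a 1 + a 2) t⁴ / 24`, the degree is `2 (a 0 + a 1 + a 2)`, that is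
`4`, `4` and `8`. Dimension three comes from four explicit elements that form a transcendence basis.
-/

/-! ### Krull dimension through transcendence degree -/

theorem ringKrullDim_eq_of_isIntegral_of_injective {R S : Type*} [CommRing R] [CommRing S]
    [Algebra R S] [Algebra.IsIntegral R S] [FaithfulSMul R S] :
    ringKrullDim S = ringKrullDim R := by
  -- Incomparability gives `≤`. For `≥`, a chain of primes lifts by lying over at its head and then
  -- going up.
  refine le_antisymm (Order.krullDim_le_of_strictMono (PrimeSpectrum.comap (algebraMap R S))
    fun p q h => ?_) (iSup_le fun l => ?_)
  · exact Ideal.IsIntegral.comap_lt_comap (R := R) (A := S) h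
  · obtain ⟨Q, hQ, hQl⟩ := (Ideal.nonempty_primesOver (S := S) l.head.asIdeal).some
    obtain ⟨L, hL, -⟩ := Ideal.exists_ltSeries_of_hasGoingUp l Q
    rw [← hL]
    exact Order.LTSeries.length_le_krullDim L

/-- Noether normalization: `A` is integral over a polynomial ring, whose number of variables is both
its Krull dimension and the transcendence degree. -/
theorem ringKrullDim_eq_of_trdeg {K A : Type*} [Field K] [CommRing A] [IsDomain A] [Algebra K A]
    [Algebra.FiniteType K A] {n : ℕ} (h : Algebra.trdeg K A = n) : ringKrullDim A = n := by
  obtain ⟨s, f, hf, hint⟩ := exists_integral_inj_algHom_of_fg K A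
  let := f.toRingHom.toAlgebra
  have : IsScalarTower K (MvPolynomial (Fin s) K) A :=
    IsScalarTower.of_algebraMap_eq fun x => (f.commutes x).symm
  have : Algebra.IsIntegral (MvPolynomial (Fin s) K) A := ⟨hint⟩
  have : FaithfulSMul (MvPolynomial (Fin s) K) A := (faithfulSMul_iff_algebraMap_injective _ _).2 hf
  have h1 : Algebra.trdeg K A = s := by
    have := ((IsTranscendenceBasis.mvPolynomial (Fin s) K).algebraMap_comp
      (A := A)).lift_cardinalMk_eq_trdeg
    simpa using this.symm
  have h2 : s = n := by exact_mod_cast h1.symm.trans h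
  rw [ringKrullDim_eq_of_isIntegral_of_injective (R := MvPolynomial (Fin s) K),
    MvPolynomial.ringKrullDim_of_isNoetherianRing, ringKrullDim_eq_zero_of_field]
  simp [h2]

/-- Lets algebraicity be checked in the larger domain `B`. In the algebraic independence matroid of
`B`, the image of a transcendence basis of `A` is independent and lies in the closure of `n`
elements. -/
theorem trdeg_eq_of_isAlgebraic_adjoin {K A B : Type*} [Field K] [CommRing A] [IsDomain A]
    [Algebra K A] [CommRing B] [IsDomain B] [Algebra K B] (ψ : A →ₐ[K] B)
    (hψ : Function.Injective ψ) {n : ℕ} (ξ : Fin n → A) (hξ : AlgebraicIndependent K ξ)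
    (halg : ∀ a, IsAlgebraic (Algebra.adjoin K (Set.range (ψ ∘ ξ))) (ψ a)) :
    Algebra.trdeg K A = n := by
  refine le_antisymm ?_ (by simpa using hξ.lift_cardinalMk_le_trdeg)
  obtain ⟨x, hx⟩ := exists_isTranscendenceBasis K A
  have hB : FaithfulSMul K B := inferInstance
  let N := AlgebraicIndependent.matroid K B
  have h1 : N.Indep (ψ '' x) := by
    have := (hx.1.map' (f := ψ) hψ).to_subtype_range
    rw [Set.range_comp, Subtype.range_coe] at this
    exact this
  have h2 : ψ '' x ⊆ N.closure (Set.range (ψ ∘ ξ)) := by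
    rw [AlgebraicIndependent.matroid_closure_eq]
    rintro _ ⟨a, -, rfl⟩
    exact halg a
  have h3 : x.encard ≤ n := by
    rw [← hψ.encard_image]
    calc (ψ '' x).encard ≤ N.eRk (N.closure (Set.range (ψ ∘ ξ))) :=
          h1.encard_le_eRk_of_subset h2
      _ = N.eRk (Set.range (ψ ∘ ξ)) := N.eRk_closure_eq _
      _ ≤ (Set.range (ψ ∘ ξ)).encard := N.eRk_le_encard _
      _ ≤ n := by
        rw [← Set.image_univ]
        exact (Set.encard_image_le _ _).trans (by simp)
  rw [← hx.cardinalMk_eq_trdeg]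
  have hfin : x.Finite := Set.finite_of_encard_le_coe h3
  have := hfin.fintype
  rw [Cardinal.mk_fintype]
  rw [Set.encard_eq_coe_toFinset_card, Set.toFinset_card] at h3
  exact_mod_cast h3

/-! ### Cox rings of rational normal scrolls: generation in degree one -/

/-- The bidegrees of the variables of the Cox ring of the rational normal scroll
`S(a 0, a 1, a 2, 0)`: the variables `1` and `2` are the coordinates of the base line, the
others those of the fibres. -/
def scrollWeight (a : Fin 3 → ℕ) : Fin 6 → ℕ × ℤ :=
  ![(1, -a 0), (0, 1), (0, 1), (1, -a 1), (1, -a 2), (1, 0)]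

theorem weight_scrollWeight (a : Fin 3 → ℕ) (d : Fin 6 →₀ ℕ) :
    Finsupp.weight (scrollWeight a) d =
      (d 0 + d 3 + d 4 + d 5, (d 1 + d 2 - a 0 * d 0 - a 1 * d 3 - a 2 * d 4 : ℤ)) := by
  rw [Finsupp.weight_apply, Finsupp.sum_fintype _ _ (by simp)]
  simp only [Fin.sum_univ_six, scrollWeight]
  ext <;> simp
  ring

theorem weight_scrollWeight_eq_iff (a : Fin 3 → ℕ) (d : Fin 6 →₀ ℕ) (t : ℕ) :
    Finsupp.weight (scrollWeight a) d = (t, 0) ↔ d 0 + d 3 + d 4 + d 5 = t ∧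
      d 1 + d 2 = a 0 * d 0 + a 1 * d 3 + a 2 * d 4 := by
  rw [weight_scrollWeight, Prod.mk.injEq]
  refine and_congr_right fun _ => ?_
  zify
  constructor <;> intro h <;> linarith

/-- The degree `t` part of the homogeneous coordinate ring of the scroll `S(a 0, a 1, a 2, 0)`,
inside its Cox ring. -/
noncomputable def scrollPart (K : Type*) [Field K] (a : Fin 3 → ℕ) (t : ℕ) :
    Submodule K (MvPolynomial (Fin 6) K) :=
  weightedHomogeneousSubmodule K (scrollWeight a) (t, 0)

theorem mem_scrollPart {K : Type*} [Field K] {a : Fin 3 → ℕ} {t : ℕ}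
    {f : MvPolynomial (Fin 6) K} :
    f ∈ scrollPart K a t ↔ IsWeightedHomogeneous (scrollWeight a) f (t, 0) := Iff.rfl

/-- Choose a fibre variable occurring in the monomial, of twist `a i`. The total exponent of the
base variables is at least `a i`, so `a i` of them can be split off together with it. -/
theorem exists_le_weight_eq_one {a : Fin 3 → ℕ} {d : Fin 6 →₀ ℕ} {t : ℕ}
    (h : Finsupp.weight (scrollWeight a) d = (t + 1, 0)) :
    ∃ e ≤ d, Finsupp.weight (scrollWeight a) e = (1, 0) := by
  rw [weight_scrollWeight_eq_iff] at h
  obtain ⟨h1, h2⟩ := h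
  have key : ∀ n : ℕ, n ≤ d 1 + d 2 →
      ∃ r s : ℕ, r ≤ d 1 ∧ s ≤ d 2 ∧ r + s = n := fun n hn =>
    ⟨min n (d 1), n - min n (d 1), by omega, by omega, by omega⟩
  have build : ∀ x : Fin 6 → ℕ, (∀ i, x i ≤ d i) → x 0 + x 3 + x 4 + x 5 = 1 →
      x 1 + x 2 = a 0 * x 0 + a 1 * x 3 + a 2 * x 4 →
      ∃ e ≤ d, Finsupp.weight (scrollWeight a) e = (1, 0) := fun x hx h3 h4 =>
    ⟨Finsupp.equivFunOnFinite.symm x, fun i => hx i,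
      (weight_scrollWeight_eq_iff _ _ _).2 ⟨h3, h4⟩⟩
  rcases (by omega : 0 < d 0 ∨ 0 < d 3 ∨ 0 < d 4 ∨ 0 < d 5) with h | h | h | h
  · obtain ⟨r, s, hr, hs, hrs⟩ := key (a 0) (by nlinarith)
    refine build ![1, r, s, 0, 0, 0] (fun i => ?_) (by simp) (by simpa using hrs)
    fin_cases i <;> simp <;> omega
  · obtain ⟨r, s, hr, hs, hrs⟩ := key (a 1) (by nlinarith)
    refine build ![0, r, s, 1, 0, 0] (fun i => ?_) (by simp) (by simpa using hrs)
    fin_cases i <;> simp <;> omega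
  · obtain ⟨r, s, hr, hs, hrs⟩ := key (a 2) (by nlinarith)
    refine build ![0, r, s, 0, 1, 0] (fun i => ?_) (by simp) (by simpa using hrs)
    fin_cases i <;> simp <;> omega
  · refine build ![0, 0, 0, 0, 0, 1] (fun i => ?_) (by simp) (by simp)
    fin_cases i <;> simp; omega

section

variable {K : Type*} [Field K] (a : Fin 3 → ℕ)

theorem monomial_mem_scrollPart_one_pow (t : ℕ) (d : Fin 6 →₀ ℕ) (r : K)
    (h : Finsupp.weight (scrollWeight a) d = (t, 0)) :
    monomial d r ∈ scrollPart K a 1 ^ t := by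
  induction t generalizing d r with
  | zero =>
    rw [weight_scrollWeight_eq_iff] at h
    have h0 : d 0 = 0 := by omega
    have h3 : d 3 = 0 := by omega
    have h4 : d 4 = 0 := by omega
    have hd : d = 0 := by
      ext i
      rw [h0, h3, h4] at h
      fin_cases i <;> simp <;> omega
    rw [hd, pow_zero, Submodule.mem_one]
    exact ⟨r, rfl⟩
  | succ t ih =>
    obtain ⟨e, hed, he⟩ := exists_le_weight_eq_one h
    have hsub : Finsupp.weight (scrollWeight a) (d - e) = (t, 0) := by
      rw [weight_scrollWeight_eq_iff] at h he ⊢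
      have := fun i => hed i
      simp only [Finsupp.tsub_apply]
      refine ⟨by have := hed 0; have := hed 3; have := hed 4; have := hed 5; omega, ?_⟩
      zify [hed 0, hed 1, hed 2, hed 3, hed 4]
      have h2 := h.2
      have he2 := he.2
      zify at h2 he2
      linarith
    have hm : monomial d r = monomial (d - e) r * monomial e 1 := by
      rw [monomial_mul, mul_one, tsub_add_cancel_of_le hed]
    rw [hm, pow_succ]
    exact Submodule.mul_mem_mul (ih _ _ hsub) (isWeightedHomogeneous_monomial _ _ _ he)

theorem scrollPart_one_pow (t : ℕ) : scrollPart K a 1 ^ t = scrollPart K a t := by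
  refine le_antisymm ?_ fun f hf => ?_
  · induction t with
    | zero =>
      rw [pow_zero, Submodule.one_le]
      exact isWeightedHomogeneous_one K _
    | succ t ih =>
      rw [pow_succ]
      exact Submodule.mul_le.2 fun f hf g hg => (mem_scrollPart.1 (ih hf)).mul hg
  · induction (mem_scrollPart.1 hf) using IsWeightedHomogeneous.induction_on with
    | zero => exact Submodule.zero_mem _
    | add p q hp hq h1 h2 => exact Submodule.add_mem _ (h1 hp) (h2 hq)
    | monomial d r hr => exact monomial_mem_scrollPart_one_pow a t d r hr

/-- Both sides are the `t`-th powers of their degree one parts. -/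
theorem map_homogeneousSubmodule_eq_scrollPart {σ : Type*}
    (Φ : MvPolynomial σ K →ₐ[K] MvPolynomial (Fin 6) K)
    (hΦ : Submodule.span K (Set.range fun i => Φ (X i)) = scrollPart K a 1) (t : ℕ) :
    (homogeneousSubmodule σ K t).map Φ.toLinearMap = scrollPart K a t := by
  rw [← homogeneousSubmodule_one_pow, Submodule.map_pow, homogeneousSubmodule_one_eq_span_X,
    Submodule.map_span, ← Set.range_comp, ← scrollPart_one_pow, ← hΦ]
  rfl

/-! ### Counting monomials on a scroll -/

theorem two_mul_sum_linear (c a₂ : ℤ) (n : ℕ) :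
    2 * ∑ k ∈ Finset.range n, (c + a₂ * k) = 2 * c * n + a₂ * (n * (n - 1)) := by
  induction n with
  | zero => simp
  | succ n ih => rw [Finset.sum_range_succ, mul_add, ih]; push_cast; ring

/-- Splitting off `j = 0` leaves a sum of one dimension less, and reindexing the rest replaces `c`
by `c + a₁`; hence the induction is over all `c`. -/
theorem six_mul_sum_linear (c a₁ a₂ : ℤ) (n : ℕ) :
    6 * ∑ j ∈ Finset.range n, ∑ k ∈ Finset.range (n - j), (c + a₁ * j + a₂ * k) =
      3 * c * (n * (n + 1)) + (a₁ + a₂) * ((n + 1) * n * (n - 1)) := by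
  induction n generalizing c with
  | zero => simp
  | succ n ih =>
    rw [Finset.sum_range_succ', mul_add]
    have h1 := ih (c + a₁)
    have h2 := two_mul_sum_linear c a₂ (n + 1)
    simp only [Nat.add_sub_add_right, Nat.sub_zero, Nat.cast_zero, mul_zero, add_zero] at h1 h2 ⊢
    have h3 : ∀ j k : ℕ, c + a₁ * ((j + 1 : ℕ) : ℤ) + a₂ * k = c + a₁ + a₁ * j + a₂ * k := by
      intro j k; push_cast; ring
    simp only [h3]
    rw [h1]
    push_cast at h2 ⊢
    linear_combination 3 * h2

theorem twentyfour_mul_sum_linear (c a₀ a₁ a₂ : ℤ) (n : ℕ) :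
    24 * ∑ i ∈ Finset.range n, ∑ j ∈ Finset.range (n - i), ∑ k ∈ Finset.range (n - i - j),
      (c + a₀ * i + a₁ * j + a₂ * k) =
      4 * c * (n * (n + 1) * (n + 2)) + (a₀ + a₁ + a₂) * ((n + 2) * (n + 1) * n * (n - 1)) := by
  induction n generalizing c with
  | zero => simp
  | succ n ih =>
    rw [Finset.sum_range_succ', mul_add]
    have h1 := ih (c + a₀)
    have h2 := six_mul_sum_linear c a₁ a₂ (n + 1)
    simp only [Nat.add_sub_add_right, Nat.sub_zero, Nat.cast_zero, mul_zero, add_zero] at h1 h2 ⊢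
    have h3 : ∀ i j k : ℕ, c + a₀ * ((i + 1 : ℕ) : ℤ) + a₁ * j + a₂ * k =
        c + a₀ + a₀ * i + a₁ * j + a₂ * k := by
      intro i j k; push_cast; ring
    simp only [h3]
    rw [h1]
    push_cast at h2 ⊢
    linear_combination 4 * h2

/-- The monomials of degree `t` on the scroll, listed by the exponents of the variables
`0`, `3`, `4` and `1`. -/
def scrollExponents (a : Fin 3 → ℕ) (t : ℕ) : Finset (Σ _ : ℕ, Σ _ : ℕ, Σ _ : ℕ, ℕ) :=
  (Finset.range (t + 1)).sigma fun i => (Finset.range (t + 1 - i)).sigma fun j =>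
    (Finset.range (t + 1 - i - j)).sigma fun k =>
      Finset.range (1 + a 0 * i + a 1 * j + a 2 * k)

theorem card_scrollExponents (t : ℕ) : (24 * (scrollExponents a t).card : ℤ) =
    4 * ((t + 1) * (t + 2) * (t + 3)) +
      (a 0 + a 1 + a 2) * ((t + 3) * (t + 2) * (t + 1) * t) := by
  have := twentyfour_mul_sum_linear 1 (a 0) (a 1) (a 2) (t + 1)
  simp only [scrollExponents, Finset.card_sigma, Finset.card_range]
  push_cast at this ⊢
  rw [this]
  ring

/-- The two weight equations determine the exponents of the variables `2` and `5` from the other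
four. -/
theorem ncard_weight_scrollWeight_eq (t : ℕ) :
    {d : Fin 6 →₀ ℕ | Finsupp.weight (scrollWeight a) d = (t, 0)}.ncard =
      (scrollExponents a t).card := by
  rw [← Set.ncard_coe_finset]
  refine Set.ncard_congr (fun d _ => ⟨d 0, d 3, d 4, d 1⟩) ?_ ?_ ?_
  · intro d hd
    have hd := (weight_scrollWeight_eq_iff _ _ _).1 hd
    simp only [scrollExponents, Finset.coe_sigma, Set.mem_sigma_iff, Finset.mem_coe,
      Finset.mem_range]
    have h1 := mul_comm (a 0) (d 0)
    refine ⟨by omega, by omega, by omega, by omega⟩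
  · intro d e hd he h
    have hd := (weight_scrollWeight_eq_iff _ _ _).1 hd
    have he := (weight_scrollWeight_eq_iff _ _ _).1 he
    simp only [Sigma.mk.injEq, heq_eq_eq] at h
    obtain ⟨h0, h3, h4, h1⟩ := h
    rw [h0, h3, h4, h1] at hd
    ext i
    fin_cases i <;> simp <;> omega
  · rintro ⟨i, j, k, r⟩ h
    simp only [scrollExponents, Finset.coe_sigma, Set.mem_sigma_iff, Finset.mem_coe,
      Finset.mem_range] at h
    refine ⟨Finsupp.equivFunOnFinite.symm
      ![i, r, a 0 * i + a 1 * j + a 2 * k - r, j, k, t - i - j - k], ?_, by simp⟩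
    refine (weight_scrollWeight_eq_iff _ _ _).2 ⟨?_, ?_⟩
    · simp; omega
    · simp; omega

theorem finite_weight_scrollWeight_eq (t : ℕ) :
    {d : Fin 6 →₀ ℕ | Finsupp.weight (scrollWeight a) d = (t, 0)}.Finite := by
  by_contra h
  have h1 := ncard_weight_scrollWeight_eq a t
  -- An infinite set has `ncard` zero, but the count is positive.
  rw [Set.Infinite.ncard h] at h1
  have h2 := card_scrollExponents a t
  rw [← h1] at h2
  have : (0 : ℤ) < 4 * ((t + 1) * (t + 2) * (t + 3)) +
    (a 0 + a 1 + a 2) * ((t + 3) * (t + 2) * (t + 1) * t) := by positivity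
  simp at h2
  linarith

instance finite_scrollPart (t : ℕ) : Module.Finite K (scrollPart K a t) := by
  rw [scrollPart, weightedHomogeneousSubmodule_eq_finsupp_supported]
  have := (finite_weight_scrollWeight_eq a t).to_subtype
  exact Module.Finite.of_basis (basisRestrictSupport K _)

theorem finrank_scrollPart (t : ℕ) : (24 * Module.finrank K (scrollPart K a t) : ℤ) =
    4 * ((t + 1) * (t + 2) * (t + 3)) +
      (a 0 + a 1 + a 2) * ((t + 3) * (t + 2) * (t + 1) * t) := by
  rw [← card_scrollExponents, ← ncard_weight_scrollWeight_eq, scrollPart,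
    weightedHomogeneousSubmodule_eq_finsupp_supported]
  have := (finite_weight_scrollWeight_eq a t).to_subtype
  rw [show Module.finrank K (AddMonoidAlgebra.supported K K
    {d | Finsupp.weight (scrollWeight a) d = (t, 0)}) = _ from
    Module.finrank_eq_nat_card_basis (basisRestrictSupport K _)]
  rfl

end

/-! ### Quadric sections in the Cox ring -/

section

variable {K : Type*} [Field K] {a : Fin 3 → ℕ} {g : MvPolynomial (Fin 6) K}

/-- The component of `g * h` in bidegree `(t + 2, 0)` is `g` times the component of `h` in bidegree
`(t, 0)`; then `g` cancels. -/
theorem mem_scrollPart_of_mul_mem (hg : g ∈ scrollPart K a 2) (hg0 : g ≠ 0) {t : ℕ}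
    {h : MvPolynomial (Fin 6) K} (hgh : g * h ∈ scrollPart K a (t + 2)) :
    h ∈ scrollPart K a t := by
  let := weightedGradedAlgebra K (scrollWeight a)
  have h1 := DirectSum.coe_decompose_mul_add_of_left_mem
    (weightedHomogeneousSubmodule K (scrollWeight a)) (b := h) (j := ((t : ℕ), (0 : ℤ))) hg
  have h2 : ((2 : ℕ), (0 : ℤ)) + (t, 0) = (t + 2, 0) := by simp [add_comm]
  have hgh' : g * h ∈ weightedHomogeneousSubmodule K (scrollWeight a) (t + 2, 0) := hgh
  rw [h2, DirectSum.decompose_of_mem_same _ hgh'] at h1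
  have h3 := mul_left_cancel₀ hg0 h1
  rw [h3]
  exact SetLike.coe_mem _

/-- Rank-nullity: the part of the ideal `(g)` in degree `t + 2` is `g` times `scrollPart K a t`. -/
theorem finrank_map_mk_scrollPart (hg : g ∈ scrollPart K a 2) (hg0 : g ≠ 0) (t : ℕ) :
    Module.finrank K ((scrollPart K a (t + 2)).map
      (Ideal.Quotient.mkₐ K (Ideal.span {g})).toLinearMap) + Module.finrank K (scrollPart K a t) =
      Module.finrank K (scrollPart K a (t + 2)) := by
  set q := (Ideal.Quotient.mkₐ K (Ideal.span {g})).toLinearMap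
  have h := LinearMap.finrank_range_add_finrank_ker (q.domRestrict (scrollPart K a (t + 2)))
  rw [LinearMap.range_domRestrict] at h
  rw [← h, add_right_inj]
  have hinj : Function.Injective (LinearMap.mulLeft K g) := fun x y hxy =>
    mul_left_cancel₀ hg0 hxy
  have hker : (LinearMap.ker (q.domRestrict (scrollPart K a (t + 2)))).map
      (scrollPart K a (t + 2)).subtype = (scrollPart K a t).map (LinearMap.mulLeft K g) := by
    ext f
    simp only [Submodule.mem_map, LinearMap.mem_ker, Subtype.exists, Submodule.coe_subtype,
      LinearMap.domRestrict_apply, q, AlgHom.toLinearMap_apply, Ideal.Quotient.mkₐ_eq_mk,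
      Ideal.Quotient.eq_zero_iff_mem, Ideal.mem_span_singleton, LinearMap.mulLeft_apply]
    constructor
    · rintro ⟨f, hf, ⟨h, rfl⟩, rfl⟩
      exact ⟨h, mem_scrollPart_of_mul_mem hg hg0 hf, rfl⟩
    · rintro ⟨h, hh, rfl⟩
      refine ⟨g * h, ?_, ⟨h, rfl⟩, rfl⟩
      have := (mem_scrollPart.1 hg).mul hh
      rw [mem_scrollPart]
      convert this using 1
      simp [add_comm]
  calc Module.finrank K (scrollPart K a t)
      = Module.finrank K ((scrollPart K a t).map (LinearMap.mulLeft K g)) :=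
        (Submodule.equivMapOfInjective _ hinj _).finrank_eq
    _ = _ := hker ▸ (Submodule.equivMapOfInjective _ (Submodule.injective_subtype _) _).finrank_eq.symm

end

/-! ### Nullstellensatz, irreducibility and components in projective space -/

namespace ProjVar

variable {K : Type*} [Field K] {σ : Type*}

/-- Hilbert's Nullstellensatz for the prime, hence radical, ideal `(g)`. -/
theorem mem_vanishingIdeal_iff_dvd [IsAlgClosed K] {τ : Type*} [Finite τ]
    {g : MvPolynomial τ K} (hg : Prime g) (f : MvPolynomial τ K) :
    (∀ w, eval w g = 0 → eval w f = 0) ↔ g ∣ f := by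
  have hp : (Ideal.span {g}).IsPrime := (Ideal.span_singleton_prime hg.ne_zero).2 hg
  rw [← Ideal.mem_span_singleton, ← IsPrime.vanishingIdeal_zeroLocus (K := K) (Ideal.span {g}),
    zeroLocus_span]
  simp [mem_vanishingIdeal_iff]

end ProjVar

namespace ProjVar

variable {K : Type*} [Field K] {σ : Type*}

theorem eval_smul_of_isHomogeneous {f : MvPolynomial σ K} {d : ℕ} (hf : f.IsHomogeneous d)
    (c : K) (v : σ → K) : eval (c • v) f = c ^ d * eval v f := by
  rw [eval_eq, eval_eq, Finset.mul_sum]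
  refine Finset.sum_congr rfl fun m hm => ?_
  have hd : ∑ i ∈ m.support, m i = d := by
    have := hf (mem_support_iff.1 hm)
    rw [Finsupp.weight_apply, Finsupp.sum] at this
    simpa using this
  simp only [Pi.smul_apply, smul_eq_mul, mul_pow, Finset.prod_mul_distrib,
    Finset.prod_pow_eq_pow_sum, hd]
  ring

theorem vanishesAt_mk_iff {f : MvPolynomial σ K} {d : ℕ} (hf : f.IsHomogeneous d)
    {v : σ → K} (hv : v ≠ 0) : VanishesAt f (Projectivization.mk K v hv) ↔ eval v f = 0 := by
  constructor
  · intro h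
    exact h v (by simp [Projectivization.submodule_mk, Submodule.mem_span_singleton_self])
  · intro h w hw
    rw [Projectivization.submodule_mk] at hw
    obtain ⟨c, rfl⟩ := Submodule.mem_span_singleton.1 hw
    rw [eval_smul_of_isHomogeneous hf, h, mul_zero]

theorem mk_mem_zeroLocus_iff {s : Set (MvPolynomial σ K)}
    (hs : ∀ f ∈ s, ∃ d, f.IsHomogeneous d) {v : σ → K} (hv : v ≠ 0) :
    Projectivization.mk K v hv ∈ zeroLocus s ↔ ∀ f ∈ s, eval v f = 0 := by
  refine forall₂_congr fun f hf => ?_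
  obtain ⟨d, hd⟩ := hs f hf
  exact vanishesAt_mk_iff hd hv

theorem not_zeroLocus_subset {s t : Set (MvPolynomial σ K)}
    (hs : ∀ f ∈ s, ∃ d, f.IsHomogeneous d) (ht : ∀ f ∈ t, ∃ d, f.IsHomogeneous d) {v : σ → K}
    (hv : v ≠ 0) (hvs : ∀ f ∈ s, eval v f = 0) (hvt : ¬ ∀ f ∈ t, eval v f = 0) :
    ¬ zeroLocus s ⊆ zeroLocus t := fun h =>
  hvt ((mk_mem_zeroLocus_iff ht hv).1 (h ((mk_mem_zeroLocus_iff hs hv).2 hvs)))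

theorem isClosed_zeroLocus {s : Set (MvPolynomial σ K)} (hs : ∀ f ∈ s, ∃ d, f.IsHomogeneous d) :
    @IsClosed _ (zariskiTopology K σ) (zeroLocus s) := by
  let := zariskiTopology K σ
  refine ⟨?_⟩
  change (zeroLocus s)ᶜᶜ ∈ _
  rw [compl_compl]
  exact ⟨s, hs, rfl⟩

theorem exists_eq_compl_zeroLocus {U : Set (ℙ K (σ → K))}
    (hU : @IsOpen _ (zariskiTopology K σ) U) :
    ∃ s : Set (MvPolynomial σ K), (∀ f ∈ s, ∃ d, f.IsHomogeneous d) ∧ Uᶜ = zeroLocus s :=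
  hU

theorem isIrreducible_of_isPrime_vanishingIdeal {Z : Set (ℙ K (σ → K))} (hZ : Z.Nonempty)
    (hI : (vanishingIdeal Z).IsPrime) : @IsIrreducible _ (zariskiTopology K σ) Z := by
  let := zariskiTopology K σ
  have key : ∀ U : Set (ℙ K (σ → K)), IsOpen U → (Z ∩ U).Nonempty →
      ∃ f ∉ vanishingIdeal Z, ∀ P ∉ U, VanishesAt f P := by
    rintro U hU ⟨P, hPZ, hPU⟩
    obtain ⟨s, -, hsU⟩ := exists_eq_compl_zeroLocus hU
    have hP : P ∉ zeroLocus s := by rw [← hsU]; simpa using hPU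
    simp only [zeroLocus, Set.mem_ofPred_eq, not_forall] at hP
    obtain ⟨f, hf, hfP⟩ := hP
    refine ⟨f, fun h => hfP (h P hPZ), fun Q hQ => ?_⟩
    have hQ' : Q ∈ zeroLocus s := by rw [← hsU]; exact hQ
    exact hQ' f hf
  refine ⟨hZ, fun U V hU hV hZU hZV => ?_⟩
  obtain ⟨f, hf, hfU⟩ := key U hU hZU
  obtain ⟨h, hh, hhV⟩ := key V hV hZV
  by_contra hemp
  refine (hI.mul_notMem hf hh) fun P hP v hv => ?_
  by_cases hPU : P ∈ U
  · have hPV : P ∉ V := fun hPV => hemp ⟨P, hP, hPU, hPV⟩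
    rw [map_mul, hhV P hPV v hv, mul_zero]
  · rw [map_mul, hfU P hPU v hv, zero_mul]

theorem components_union_three {Z₁ Z₂ Z₃ : Set (ℙ K (σ → K))}
    (h₁ : @IsIrreducible _ (zariskiTopology K σ) Z₁)
    (h₂ : @IsIrreducible _ (zariskiTopology K σ) Z₂)
    (h₃ : @IsIrreducible _ (zariskiTopology K σ) Z₃)
    (c₁ : @IsClosed _ (zariskiTopology K σ) Z₁) (c₂ : @IsClosed _ (zariskiTopology K σ) Z₂)
    (c₃ : @IsClosed _ (zariskiTopology K σ) Z₃) (h12 : ¬ Z₁ ⊆ Z₂) (h13 : ¬ Z₁ ⊆ Z₃)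
    (h21 : ¬ Z₂ ⊆ Z₁) (h23 : ¬ Z₂ ⊆ Z₃) (h31 : ¬ Z₃ ⊆ Z₁) (h32 : ¬ Z₃ ⊆ Z₂) :
    components (Z₁ ∪ Z₂ ∪ Z₃) = {Z₁, Z₂, Z₃} := by
  let := zariskiTopology K σ
  have key : ∀ s, s ⊆ Z₁ ∪ Z₂ ∪ Z₃ → IsIrreducible s → s ⊆ Z₁ ∨ s ⊆ Z₂ ∨ s ⊆ Z₃ := by
    intro s hs hirr
    have h := isIrreducible_iff_sUnion_isClosed.1 hirr {Z₁, Z₂, Z₃} (by simp [c₁, c₂, c₃])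
      (by simpa [← Set.union_assoc] using hs)
    simpa using h
  ext s
  simp only [components, Set.mem_ofPred_eq, Set.mem_insert_iff, Set.mem_singleton_iff]
  constructor
  · rintro ⟨⟨hs, hirr⟩, hmax⟩
    rcases key s hs hirr with h | h | h
    · exact Or.inl (h.antisymm (hmax ⟨fun x hx => Or.inl (Or.inl hx), h₁⟩ h))
    · exact Or.inr (Or.inl (h.antisymm (hmax ⟨fun x hx => Or.inl (Or.inr hx), h₂⟩ h)))
    · exact Or.inr (Or.inr (h.antisymm (hmax ⟨fun x hx => Or.inr hx, h₃⟩ h)))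
  · rintro (rfl | rfl | rfl)
    · refine ⟨⟨fun x hx => Or.inl (Or.inl hx), h₁⟩, fun t ⟨ht, hirr⟩ hst => ?_⟩
      rcases key t ht hirr with h | h | h
      exacts [h, (h12 (hst.trans h)).elim, (h13 (hst.trans h)).elim]
    · refine ⟨⟨fun x hx => Or.inl (Or.inr hx), h₂⟩, fun t ⟨ht, hirr⟩ hst => ?_⟩
      rcases key t ht hirr with h | h | h
      exacts [(h21 (hst.trans h)).elim, h, (h23 (hst.trans h)).elim]
    · refine ⟨⟨fun x hx => Or.inr hx, h₃⟩, fun t ⟨ht, hirr⟩ hst => ?_⟩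
      rcases key t ht hirr with h | h | h
      exacts [(h31 (hst.trans h)).elim, (h32 (hst.trans h)).elim, h]

theorem HasDim.unique {Z : Set (ℙ K (σ → K))} {m n : ℕ} (hm : HasDim Z m) (hn : HasDim Z n) :
    m = n := by
  have h : ((m + 1 : ℕ) : WithBot ℕ∞) = ((n + 1 : ℕ) : WithBot ℕ∞) := hm.symm.trans hn
  have : m + 1 = n + 1 := by exact_mod_cast h
  omega

theorem HasDegree.unique {Z : Set (ℙ K (σ → K))} {d e : ℕ} (hd : HasDegree Z d)
    (he : HasDegree Z e) : d = e := by
  obtain ⟨m, hm, hd⟩ := hd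
  obtain ⟨n, hn, he⟩ := he
  obtain rfl := hm.unique hn
  exact_mod_cast tendsto_nhds_unique hd he

end ProjVar

/-! ### Ideal, Hilbert function, degree and dimension of a scroll section -/

namespace ProjVar

variable {K : Type*} [Field K] {σ : Type*}

/-- The zero locus of `s` is the section of the rational normal scroll `S(a 0, a 1, a 2, 0)` by
the quadric `g`, embedded by the linear forms `Φ (X i)`. -/
structure IsScrollSection (a : Fin 3 → ℕ) (g : MvPolynomial (Fin 6) K)
    (Φ : MvPolynomial σ K →ₐ[K] MvPolynomial (Fin 6) K) (s : Set (MvPolynomial σ K)) : Prop where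
  homogeneous : ∀ f ∈ s, ∃ d, f.IsHomogeneous d
  span_eq : Submodule.span K (Set.range fun i => Φ (X i)) = scrollPart K a 1
  prime : Prime g
  mem : g ∈ scrollPart K a 2
  cone_iff : ∀ v : σ → K, (∀ f ∈ s, eval v f = 0) ↔
    ∃ w, eval w g = 0 ∧ v = fun i => eval w (Φ (X i))
  nonempty : ∃ v : σ → K, v ≠ 0 ∧ ∀ f ∈ s, eval v f = 0

namespace IsScrollSection

variable {a : Fin 3 → ℕ} {g : MvPolynomial (Fin 6) K}
  {Φ : MvPolynomial σ K →ₐ[K] MvPolynomial (Fin 6) K} {s : Set (MvPolynomial σ K)}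

theorem nonempty_zeroLocus (h : IsScrollSection a g Φ s) : (zeroLocus s).Nonempty := by
  obtain ⟨v, hv, hs⟩ := h.nonempty
  exact ⟨_, (mk_mem_zeroLocus_iff h.homogeneous hv).2 hs⟩

theorem eval_apply (Φ : MvPolynomial σ K →ₐ[K] MvPolynomial (Fin 6) K) (w : Fin 6 → K)
    (f : MvPolynomial σ K) : eval w (Φ f) = eval (fun i => eval w (Φ (X i))) f := by
  have : (aeval w).comp Φ = aeval (fun i => eval w (Φ (X i))) := by
    ext i
    simp
  simpa [coe_aeval_eq_eval] using DFunLike.congr_fun this f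

/-- The cone over the section is the image of the hypersurface `g = 0`, so `f` vanishes on it
exactly when `Φ f` vanishes where `g` does. -/
theorem mem_vanishingIdeal_iff [IsAlgClosed K] (h : IsScrollSection a g Φ s)
    (f : MvPolynomial σ K) : f ∈ vanishingIdeal (zeroLocus s) ↔ g ∣ Φ f := by
  rw [← mem_vanishingIdeal_iff_dvd h.prime]
  constructor
  · intro hf w hw
    rw [eval_apply]
    set v : σ → K := fun i => eval w (Φ (X i)) with hvdef
    have hvs : ∀ f ∈ s, eval v f = 0 := (h.cone_iff v).2 ⟨w, hw, rfl⟩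
    -- Some `w` map to the zero vector, which is not a projective point. There `f` vanishes because
    -- `VanishesAt` at any point of the section includes the zero vector of the line.
    by_cases hv : v = 0
    · obtain ⟨P, hP⟩ := h.nonempty_zeroLocus
      rw [hv]
      exact hf P hP 0 (Submodule.zero_mem _)
    · refine hf _ ((mk_mem_zeroLocus_iff h.homogeneous hv).2 hvs) v ?_
      simp [Projectivization.submodule_mk, Submodule.mem_span_singleton_self]
  · intro hf P hP v hv
    obtain ⟨w, hw, rfl⟩ := (h.cone_iff v).1 fun f hf => hP f hf v hv
    rw [← eval_apply]
    exact hf w hw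

/-- The homogeneous coordinate ring of a scroll section maps to the Cox ring modulo the
quadric. -/
noncomputable def toQuotient [IsAlgClosed K] (h : IsScrollSection a g Φ s) :
    (MvPolynomial σ K ⧸ vanishingIdeal (zeroLocus s)) →ₐ[K]
      MvPolynomial (Fin 6) K ⧸ Ideal.span {g} :=
  Ideal.Quotient.liftₐ _ ((Ideal.Quotient.mkₐ K (Ideal.span {g})).comp Φ) fun f hf => by
    simpa [Ideal.Quotient.eq_zero_iff_mem, Ideal.mem_span_singleton] using
      (h.mem_vanishingIdeal_iff f).1 hf

theorem toQuotient_mk [IsAlgClosed K] (h : IsScrollSection a g Φ s) (f : MvPolynomial σ K) :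
    h.toQuotient (Ideal.Quotient.mk _ f) = Ideal.Quotient.mk _ (Φ f) := rfl

theorem toQuotient_injective [IsAlgClosed K] (h : IsScrollSection a g Φ s) :
    Function.Injective h.toQuotient := by
  rw [injective_iff_map_eq_zero]
  intro x hx
  obtain ⟨f, rfl⟩ := Ideal.Quotient.mk_surjective x
  rw [toQuotient_mk, Ideal.Quotient.eq_zero_iff_mem, Ideal.mem_span_singleton] at hx
  rw [Ideal.Quotient.eq_zero_iff_mem]
  exact (h.mem_vanishingIdeal_iff f).2 hx

theorem isPrime_span (h : IsScrollSection a g Φ s) : (Ideal.span {g}).IsPrime :=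
  (Ideal.span_singleton_prime h.prime.ne_zero).2 h.prime

theorem isPrime_vanishingIdeal [IsAlgClosed K] (h : IsScrollSection a g Φ s) :
    (vanishingIdeal (zeroLocus s)).IsPrime := by
  have := h.isPrime_span
  have : vanishingIdeal (zeroLocus s) = (Ideal.span {g}).comap Φ := by
    ext f
    rw [h.mem_vanishingIdeal_iff, Ideal.mem_comap, Ideal.mem_span_singleton]
  rw [this]
  exact Ideal.comap_isPrime _ _

theorem isIrreducible [IsAlgClosed K] (h : IsScrollSection a g Φ s) :
    @IsIrreducible _ (zariskiTopology K σ) (zeroLocus s) :=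
  isIrreducible_of_isPrime_vanishingIdeal h.nonempty_zeroLocus h.isPrime_vanishingIdeal

theorem hilbertFunction_eq [IsAlgClosed K] (h : IsScrollSection a g Φ s) (t : ℕ) :
    hilbertFunction (zeroLocus s) t = Module.finrank K ((scrollPart K a t).map
      (Ideal.Quotient.mkₐ K (Ideal.span {g})).toLinearMap) := by
  rw [hilbertFunction, ← map_homogeneousSubmodule_eq_scrollPart a Φ h.span_eq,
    ← Submodule.map_comp]
  have : (Ideal.Quotient.mkₐ K (Ideal.span {g})).toLinearMap ∘ₗ Φ.toLinearMap =
      h.toQuotient.toLinearMap ∘ₗ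
        (Ideal.Quotient.mkₐ K (vanishingIdeal (zeroLocus s))).toLinearMap := rfl
  rw [this, Submodule.map_comp]
  exact (Submodule.equivMapOfInjective _ h.toQuotient_injective _).finrank_eq

theorem hilbertFunction_add_two [IsAlgClosed K] (h : IsScrollSection a g Φ s) (t : ℕ) :
    (hilbertFunction (zeroLocus s) (t + 2) : ℝ) =
      (t + 3) ^ 2 + (a 0 + a 1 + a 2) * ((t + 2) * (t + 3) * (2 * t + 5)) / 6 := by
  have h1 := finrank_map_mk_scrollPart h.mem h.prime.ne_zero t
  rw [← h.hilbertFunction_eq] at h1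
  have h2 := finrank_scrollPart (K := K) a t
  have h3 := finrank_scrollPart (K := K) a (t + 2)
  rw [← h1] at h3
  have h2' : (24 * Module.finrank K (scrollPart K a t) : ℝ) =
    4 * ((t + 1) * (t + 2) * (t + 3)) +
      (a 0 + a 1 + a 2) * ((t + 3) * (t + 2) * (t + 1) * t) := by exact_mod_cast h2
  have h3' : (24 * (hilbertFunction (zeroLocus s) (t + 2) +
      Module.finrank K (scrollPart K a t)) : ℝ) =
    4 * ((t + 2 + 1) * (t + 2 + 2) * (t + 2 + 3)) +
      (a 0 + a 1 + a 2) * ((t + 2 + 3) * (t + 2 + 2) * (t + 2 + 1) * (t + 2)) := by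
    exact_mod_cast h3
  linear_combination (h3' - h2') / 24

theorem hasDegree [IsAlgClosed K] (h : IsScrollSection a g Φ s)
    (hdim : HasDim (zeroLocus s) 3) (ha : a 0 + a 1 + a 2 ≠ 0) :
    HasDegree (zeroLocus s) (2 * (a 0 + a 1 + a 2)) := by
  set e : ℝ := a 0 + a 1 + a 2 with he
  have he0 : e / 3 ≠ 0 := by
    have : e ≠ 0 := by rw [he]; exact_mod_cast ha
    positivity
  -- This is `(t + 1)² + e t (t + 1) (2 t + 1) / 6` expanded; its leading coefficient times `3!` is
  -- `2 e`.
  refine hasDegree_of_hilbertPolynomial hdim (P := Polynomial.C (e / 3) * Polynomial.X ^ 3 +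
    Polynomial.C (e / 2 + 1) * Polynomial.X ^ 2 + Polynomial.C (e / 6 + 2) * Polynomial.X +
    Polynomial.C 1) ?_ (Polynomial.natDegree_cubic he0) ?_
  · filter_upwards [eventually_ge_atTop 2] with t ht
    obtain ⟨t, rfl⟩ := Nat.exists_eq_add_of_le' ht
    rw [h.hilbertFunction_add_two, ← he]
    simp
    ring
  · rw [Polynomial.leadingCoeff_cubic he0]
    push_cast [← he, Nat.factorial]
    ring

/-- `hind` says that the map `ξ` from `g = 0` to affine space hits everything off the hypersurface
`F = 0`, so the `ξ i` are independent modulo `g`; `halg` makes the coordinate ring algebraic over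
them. -/
theorem hasDim [IsAlgClosed K] [Finite σ] (h : IsScrollSection a g Φ s) {n : ℕ}
    (ξ : Fin (n + 1) → MvPolynomial (Fin 6) K) (hξ : ∀ i, ξ i ∈ scrollPart K a 1)
    (hind : ∃ F : MvPolynomial (Fin (n + 1)) K, F ≠ 0 ∧ ∀ x, eval x F ≠ 0 →
      ∃ w, eval w g = 0 ∧ ∀ i, eval w (ξ i) = x i)
    (halg : ∀ f ∈ scrollPart K a 1, IsAlgebraic (Algebra.adjoin K
      (Set.range fun i => Ideal.Quotient.mk (Ideal.span {g}) (ξ i)))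
        (Ideal.Quotient.mk (Ideal.span {g}) f)) :
    HasDim (zeroLocus s) n := by
  have := h.isPrime_vanishingIdeal
  have := h.isPrime_span
  have hpre : ∀ i, ∃ x, Φ x = ξ i := fun i => by
    have hi := hξ i
    rw [← map_homogeneousSubmodule_eq_scrollPart a Φ h.span_eq] at hi
    obtain ⟨x, -, hx⟩ := hi
    exact ⟨x, hx⟩
  choose x hx using hpre
  set I := vanishingIdeal (zeroLocus s)
  have hcomp : h.toQuotient ∘ (fun i => Ideal.Quotient.mk I (x i)) =
      fun i => Ideal.Quotient.mk (Ideal.span {g}) (ξ i) := by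
    funext i
    simp only [Function.comp_apply, I, toQuotient_mk, hx]
  refine ringKrullDim_eq_of_trdeg (K := K) (trdeg_eq_of_isAlgebraic_adjoin h.toQuotient
    h.toQuotient_injective (fun i => Ideal.Quotient.mk I (x i)) ?_ fun y => ?_)
  · rw [AlgebraicIndependent, injective_iff_map_eq_zero]
    intro G hG
    obtain ⟨F, hF0, hF⟩ := hind
    have h1 : h.toQuotient (aeval (fun i => Ideal.Quotient.mk I (x i)) G) = 0 := by
      rw [hG, map_zero]
    have h2 : Ideal.Quotient.mk (Ideal.span {g}) (aeval ξ G) = 0 := by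
      rw [← h1, comp_aeval_apply, ← Function.comp_def h.toQuotient, hcomp]
      exact comp_aeval_apply ξ (Ideal.Quotient.mkₐ K (Ideal.span {g})) G
    rw [Ideal.Quotient.eq_zero_iff_mem, Ideal.mem_span_singleton,
      ← mem_vanishingIdeal_iff_dvd h.prime] at h2
    -- A relation `G` among the `ξ i` vanishes wherever `F` does not.
    have h3 : G * F = 0 := by
      refine MvPolynomial.funext fun y => ?_
      rw [map_mul, map_zero]
      by_cases hy : eval y F = 0
      · rw [hy, mul_zero]
      · obtain ⟨w, hw, hwy⟩ := hF y hy
        have h4 : eval w (aeval ξ G) = eval (fun i => eval w (ξ i)) G :=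
          comp_aeval_apply ξ (aeval w) G
        rw [_root_.funext hwy, h2 w hw] at h4
        rw [← h4, zero_mul]
    exact (mul_eq_zero.1 h3).resolve_right hF0
  · rw [hcomp]
    obtain ⟨f, rfl⟩ := Ideal.Quotient.mk_surjective y
    induction f using MvPolynomial.induction_on with
    | C c =>
      have hc : h.toQuotient (Ideal.Quotient.mk I (C c)) = algebraMap K _ c :=
        h.toQuotient.commutes c
      rw [hc, IsScalarTower.algebraMap_apply K (Algebra.adjoin K
        (Set.range fun i => Ideal.Quotient.mk (Ideal.span {g}) (ξ i)))]
      exact isAlgebraic_algebraMap _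
    | add p q hp hq => rw [map_add, map_add]; exact hp.add hq
    | mul_X p i hp =>
      rw [map_mul, map_mul]
      refine hp.mul ?_
      rw [toQuotient_mk]
      refine halg _ ?_
      rw [← h.span_eq]
      exact Submodule.subset_span ⟨i, rfl⟩

end IsScrollSection

end ProjVar

/-! ### Primality of the two quadrics -/

/-- Eisenstein at `π`, which divides the constant term exactly once; `hrel` is primitivity. -/
theorem Polynomial.prime_quadratic_of_eisenstein {R : Type*} [CommRing R] [IsDomain R]
    [UniqueFactorizationMonoid R] {α δ π : R} (hπ : Prime π) (hα : ¬ π ∣ α) (hδ : ¬ π ∣ δ)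
    (hrel : ∀ r, r ∣ α → r ∣ π * δ → IsUnit r) :
    Prime (Polynomial.C α * Polynomial.X ^ 2 - Polynomial.C (π * δ)) := by
  have hα0 : α ≠ 0 := fun h => hα (h ▸ dvd_zero π)
  have hform : Polynomial.C α * Polynomial.X ^ 2 - Polynomial.C (π * δ) =
      Polynomial.C α * Polynomial.X ^ 2 + Polynomial.C 0 * Polynomial.X +
        Polynomial.C (-(π * δ)) := by
    simp [sub_eq_add_neg]
  have hP : (Ideal.span {π}).IsPrime := (Ideal.span_singleton_prime hπ.ne_zero).2 hπ
  have hdeg := Polynomial.degree_quadratic (b := 0) (c := -(π * δ)) hα0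
  refine (Polynomial.irreducible_of_eisenstein_criterion hP ?_ ?_ ?_ ?_ ?_).prime
  · rwa [hform, Polynomial.leadingCoeff_quadratic hα0, Ideal.mem_span_singleton]
  · intro n hn
    rw [hform, hdeg] at hn
    have hn2 : n < 2 := by exact_mod_cast hn
    rw [Ideal.mem_span_singleton]
    interval_cases n
    · simp
    · simp
  · rw [hform, hdeg]
    exact Nat.cast_pos.2 two_pos
  · rw [Ideal.span_singleton_pow, Ideal.mem_span_singleton]
    simp only [Polynomial.coeff_sub, Polynomial.coeff_C_zero, Polynomial.mul_coeff_zero,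
      Polynomial.coeff_X_pow]
    rw [pow_two]
    simpa [mul_dvd_mul_iff_left hπ.ne_zero] using hδ
  · intro r hr
    obtain ⟨q, hq⟩ := hr
    refine hrel r ⟨q.coeff 2, ?_⟩ ⟨-q.coeff 0, ?_⟩
    · have := congrArg (fun f => Polynomial.coeff f 2) hq
      simpa [Polynomial.coeff_C] using this
    · have := congrArg (fun f => Polynomial.coeff f 0) hq
      simp only [Polynomial.coeff_sub, Polynomial.coeff_C_zero, Polynomial.mul_coeff_zero,
        Polynomial.coeff_X_pow, OfNat.zero_ne_ofNat, if_false, mul_zero] at this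
      linear_combination -this

namespace MvPolynomial

variable {K : Type*} [Field K] {n : ℕ}

theorem prime_X_sub_mul_X (c : K) :
    Prime (X 0 - C c * X 1 : MvPolynomial (Fin (n + 2)) K) := by
  rw [← MulEquiv.prime_iff (finSuccEquiv K (n + 1))]
  have : finSuccEquiv K (n + 1) (X 0 - C c * X 1) =
      Polynomial.X - Polynomial.C (C c * X 0) := by
    rw [map_sub, map_mul, finSuccEquiv_X_zero, show (1 : Fin (n + 2)) = Fin.succ 0 from rfl,
      finSuccEquiv_X_succ, finSuccEquiv_apply]
    simp
  rw [this]
  exact Polynomial.prime_X_sub_C _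

theorem not_dvd_of_eval {σ : Type*} {f g : MvPolynomial σ K} (w : σ → K) (hf : eval w f = 0)
    (hg : eval w g ≠ 0) : ¬ f ∣ g := by
  rintro ⟨h, rfl⟩
  exact hg (by rw [map_mul, hf, zero_mul])

theorem finSuccEquiv_rename_succ (p : MvPolynomial (Fin n) K) :
    finSuccEquiv K n (rename Fin.succ p) = Polynomial.C p := by
  induction p using MvPolynomial.induction_on with
  | C c => rw [rename_C, finSuccEquiv_apply]; simp
  | add p q hp hq => rw [map_add, map_add, hp, hq, Polynomial.C_add]
  | mul_X p i hp => rw [map_mul, map_mul, hp, rename_X, finSuccEquiv_X_succ, Polynomial.C_mul]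

theorem prime_quadratic {α δ π : MvPolynomial (Fin n) K} (hπ : Prime π) (hα : ¬ π ∣ α)
    (hδ : ¬ π ∣ δ) (hrel : ∀ r, r ∣ α → r ∣ π * δ → IsUnit r) :
    Prime (rename Fin.succ α * X 0 ^ 2 - rename Fin.succ (π * δ)) := by
  rw [← MulEquiv.prime_iff (finSuccEquiv K n)]
  have : finSuccEquiv K n (rename Fin.succ α * X 0 ^ 2 - rename Fin.succ (π * δ)) =
      Polynomial.C α * Polynomial.X ^ 2 - Polynomial.C (π * δ) := by
    rw [map_sub, map_mul, map_pow, finSuccEquiv_X_zero, finSuccEquiv_rename_succ,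
      finSuccEquiv_rename_succ]
  rw [this]
  exact Polynomial.prime_quadratic_of_eisenstein hπ hα hδ hrel

end MvPolynomial

/-- The quadric section defining the components of degree four. -/
noncomputable def quadricFour {K : Type*} [Field K] (b : K) : MvPolynomial (Fin 6) K :=
  C (1 - b ^ 2) * X 0 ^ 2 - (X 1 ^ 2 - X 2 ^ 2) * (X 3 ^ 2 - X 4 ^ 2)

/-- The quadric section defining the component of degree eight. -/
noncomputable def quadricEight {K : Type*} [Field K] (b : K) : MvPolynomial (Fin 6) K :=
  (X 1 ^ 2 - X 2 ^ 2) * X 0 ^ 2 - (X 1 ^ 2 - C (b ^ 2) * X 2 ^ 2) *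
    (X 3 ^ 2 + C (1 - b ^ 2) * (X 1 ^ 2 - X 2 ^ 2) * X 4 ^ 2)

section

variable {K : Type*} [Field K] {b : K}

theorem prime_quadricFour (h2 : (2 : K) ≠ 0) (hb1 : b ^ 2 ≠ 1) : Prime (quadricFour b) := by
  have hb : 1 - b ^ 2 ≠ 0 := sub_ne_zero.2 hb1.symm
  have hu : IsUnit (C (1 - b ^ 2) : MvPolynomial (Fin 5) K) := (IsUnit.mk0 _ hb).map C
  -- Eisenstein in the variable `0` at the factor `X 1 - X 2`; dropping that variable lowers the
  -- other indices by one.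
  have hπ := prime_X_sub_mul_X (n := 3) (1 : K)
  have := prime_quadratic (α := C (1 - b ^ 2)) (π := X 0 - C 1 * X 1)
    (δ := (X 0 + X 1) * (X 2 ^ 2 - X 3 ^ 2)) hπ ?_ ?_ fun r hr _ => isUnit_of_dvd_unit hr hu
  · convert this using 1
    simp only [quadricFour, map_mul, map_sub, map_add, map_pow, rename_C, rename_X]
    have e1 : Fin.succ (0 : Fin 5) = 1 := rfl
    have e2 : Fin.succ (1 : Fin 5) = 2 := rfl
    have e3 : Fin.succ (2 : Fin 5) = 3 := rfl
    have e4 : Fin.succ (3 : Fin 5) = 4 := rfl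
    rw [e1, e2, e3, e4, C_1]
    ring
  · exact not_dvd_of_eval ![1, 1, 0, 0, 0] (by simp) (by simpa using hb)
  · exact not_dvd_of_eval ![1, 1, 1, 0, 0] (by simp) (by simpa [one_add_one_eq_two] using h2)

theorem prime_quadricEight (h2 : (2 : K) ≠ 0) (hb0 : b ≠ 0) (hb1 : b ^ 2 ≠ 1) :
    Prime (quadricEight b) := by
  have hb : 1 - b ^ 2 ≠ 0 := sub_ne_zero.2 hb1.symm
  -- Eisenstein at the factor `X 1 - b X 2`, again with indices lowered by one.
  have hπ := prime_X_sub_mul_X (n := 3) b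
  set δ : MvPolynomial (Fin 5) K := (X 0 + C b * X 1) *
    (X 2 ^ 2 + C (1 - b ^ 2) * (X 0 ^ 2 - X 1 ^ 2) * X 3 ^ 2) with hδ
  have := prime_quadratic (α := X 0 ^ 2 - X 1 ^ 2) (π := X 0 - C b * X 1) (δ := δ)
    hπ ?_ ?_ ?_
  · convert this using 1
    simp only [quadricEight, hδ, map_mul, map_sub, map_add, map_pow, rename_C, rename_X]
    have e1 : Fin.succ (0 : Fin 5) = 1 := rfl
    have e2 : Fin.succ (1 : Fin 5) = 2 := rfl
    have e3 : Fin.succ (2 : Fin 5) = 3 := rfl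
    have e4 : Fin.succ (3 : Fin 5) = 4 := rfl
    rw [e1, e2, e3, e4]
    ring
  · exact not_dvd_of_eval ![b, 1, 0, 0, 0] (by simp) (by simpa using sub_ne_zero.2 hb1)
  · refine not_dvd_of_eval ![b, 1, 1, 0, 0] (by simp) ?_
    simp only [hδ]
    simp
    rw [← two_mul]
    exact mul_ne_zero h2 hb0
  · intro r hr hr'
    by_contra hunit
    have hr0 : r ≠ 0 := by
      rintro rfl
      rw [zero_dvd_iff] at hr
      have := congrArg (eval ![1, 0, 0, 0, 0]) hr
      simp at this
    obtain ⟨p, hp, hpr⟩ := WfDvdMonoid.exists_irreducible_factor hunit hr0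
    have hpα : p ∣ (X 0 - C 1 * X 1) * (X 0 - C (-1) * X 1) := by
      refine (hpr.trans hr).trans (dvd_of_eq ?_)
      simp only [C_neg, C_1]
      ring
    -- An irreducible factor of the leading coefficient would be associated to `X 0 - c X 1` with `c
    -- = ±1`. At the point below this form is zero, while the constant term is `(c - b) (c + b)`,
    -- nonzero since `b² ≠ 1`.
    have key : ∀ c : K, c ^ 2 = 1 → ¬ p ∣ X 0 - C c * X 1 := by
      intro c hc hpc
      have hassoc := (hp.prime.associated_of_dvd (prime_X_sub_mul_X c) hpc)
      refine not_dvd_of_eval (g := (X 0 - C b * X 1) * δ) ![c, 1, 1, 0, 0]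
        (by simp) ?_ (hassoc.symm.dvd.trans (hpr.trans hr'))
      simp only [hδ]
      simp
      constructor
      · intro h
        rw [sub_eq_zero] at h
        exact hb1 (h ▸ hc)
      · intro h
        rw [add_eq_zero_iff_eq_neg] at h
        rw [h] at hc
        exact hb1 (by simpa using hc)
    rcases hp.prime.dvd_or_dvd hpα with h | h
    · exact key 1 (by simp) h
    · exact key (-1) (by simp) h

end

/-! ### The two scrolls: degree one parts and dimension of the sections -/

section

variable {K : Type*} [Field K] {a : Fin 3 → ℕ}

/-- A monomial of weight `(1, 0)` contains exactly one fibre variable, to the first power. -/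
theorem scrollPart_one_le {W : Submodule K (MvPolynomial (Fin 6) K)}
    (h0 : ∀ r s, r + s = a 0 → X 1 ^ r * X 2 ^ s * X 0 ∈ W)
    (h3 : ∀ r s, r + s = a 1 → X 1 ^ r * X 2 ^ s * X 3 ∈ W)
    (h4 : ∀ r s, r + s = a 2 → X 1 ^ r * X 2 ^ s * X 4 ∈ W) (h5 : X 5 ∈ W) :
    scrollPart K a 1 ≤ W := by
  intro f hf
  induction (mem_scrollPart.1 hf) using IsWeightedHomogeneous.induction_on with
  | zero => exact W.zero_mem
  | add p q hp hq h1 h2 => exact W.add_mem (h1 hp) (h2 hq)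
  | monomial d r hr =>
    have hr := (weight_scrollWeight_eq_iff a d 1).1 (by simpa using hr)
    rw [monomial_eq, Finsupp.prod_fintype _ _ (by simp), Fin.prod_univ_six, ← smul_eq_C_mul]
    refine W.smul_mem _ ?_
    rcases (by omega : (d 0 = 1 ∧ d 3 = 0 ∧ d 4 = 0 ∧ d 5 = 0) ∨
      (d 0 = 0 ∧ d 3 = 1 ∧ d 4 = 0 ∧ d 5 = 0) ∨ (d 0 = 0 ∧ d 3 = 0 ∧ d 4 = 1 ∧ d 5 = 0) ∨
      (d 0 = 0 ∧ d 3 = 0 ∧ d 4 = 0 ∧ d 5 = 1)) with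
      ⟨e0, e3, e4, e5⟩ | ⟨e0, e3, e4, e5⟩ | ⟨e0, e3, e4, e5⟩ | ⟨e0, e3, e4, e5⟩
    all_goals
      rw [e0, e3, e4] at hr
      rw [e0, e3, e4, e5]
      simp only [pow_zero, pow_one, mul_one, one_mul]
    · rw [mul_assoc, mul_comm]
      exact h0 _ _ (by simpa using hr.2)
    · exact h3 _ _ (by simpa using hr.2)
    · exact h4 _ _ (by simpa using hr.2)
    · have : d 1 = 0 ∧ d 2 = 0 := by simpa using hr.2
      simpa [this.1, this.2] using h5

theorem mul_X_mem_scrollPart_one {r s : ℕ} {j : Fin 6}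
    (h : scrollWeight a j = (1, -((r + s : ℕ) : ℤ))) :
    (X 1 ^ r * X 2 ^ s * X j : MvPolynomial (Fin 6) K) ∈ scrollPart K a 1 := by
  have := (((isWeightedHomogeneous_X K (scrollWeight a) 1).pow r).mul
    ((isWeightedHomogeneous_X K (scrollWeight a) 2).pow s)).mul
    (isWeightedHomogeneous_X K (scrollWeight a) j)
  rw [mem_scrollPart]
  convert this using 1
  rw [h]
  simp [scrollWeight]

theorem mul_mem_scrollPart_two {f g : MvPolynomial (Fin 6) K} (hf : f ∈ scrollPart K a 1)
    (hg : g ∈ scrollPart K a 1) : f * g ∈ scrollPart K a 2 := by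
  rw [← scrollPart_one_pow, pow_two]
  exact Submodule.mul_mem_mul hf hg

theorem C_mul_mem {W : Submodule K (MvPolynomial (Fin 6) K)} {f : MvPolynomial (Fin 6) K}
    (hf : f ∈ W) (c : K) : C c * f ∈ W := by
  rw [← smul_eq_C_mul]
  exact W.smul_mem c hf

theorem mem_scrollPart_zero_one_one :
    X 0 ∈ scrollPart K ![0, 1, 1] 1 ∧ X 1 * X 3 ∈ scrollPart K ![0, 1, 1] 1 ∧
    X 2 * X 3 ∈ scrollPart K ![0, 1, 1] 1 ∧ X 1 * X 4 ∈ scrollPart K ![0, 1, 1] 1 ∧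
    X 2 * X 4 ∈ scrollPart K ![0, 1, 1] 1 ∧ X 5 ∈ scrollPart K ![0, 1, 1] 1 := by
  have key := fun r s j => mul_X_mem_scrollPart_one (K := K) (a := ![0, 1, 1]) (r := r) (s := s)
    (j := j)
  refine ⟨?_, ?_, ?_, ?_, ?_, ?_⟩
  · simpa using key 0 0 0 (by simp [scrollWeight])
  · simpa using key 1 0 3 (by simp [scrollWeight])
  · simpa using key 0 1 3 (by simp [scrollWeight])
  · simpa using key 1 0 4 (by simp [scrollWeight])
  · simpa using key 0 1 4 (by simp [scrollWeight])
  · simpa using key 0 0 5 (by simp [scrollWeight])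

theorem mem_scrollPart_one_one_two :
    X 1 * X 0 ∈ scrollPart K ![1, 1, 2] 1 ∧ X 2 * X 0 ∈ scrollPart K ![1, 1, 2] 1 ∧
    X 1 * X 3 ∈ scrollPart K ![1, 1, 2] 1 ∧ X 2 * X 3 ∈ scrollPart K ![1, 1, 2] 1 ∧
    X 1 ^ 2 * X 4 ∈ scrollPart K ![1, 1, 2] 1 ∧ X 1 * X 2 * X 4 ∈ scrollPart K ![1, 1, 2] 1 ∧
    X 2 ^ 2 * X 4 ∈ scrollPart K ![1, 1, 2] 1 ∧ X 5 ∈ scrollPart K ![1, 1, 2] 1 := by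
  have key := fun r s j => mul_X_mem_scrollPart_one (K := K) (a := ![1, 1, 2]) (r := r) (s := s)
    (j := j)
  refine ⟨?_, ?_, ?_, ?_, ?_, ?_, ?_, ?_⟩
  · simpa using key 1 0 0 (by simp [scrollWeight])
  · simpa using key 0 1 0 (by simp [scrollWeight])
  · simpa using key 1 0 3 (by simp [scrollWeight])
  · simpa using key 0 1 3 (by simp [scrollWeight])
  · simpa using key 2 0 4 (by simp [scrollWeight])
  · simpa using key 1 1 4 (by simp [scrollWeight])
  · simpa using key 0 2 4 (by simp [scrollWeight])
  · simpa using key 0 0 5 (by simp [scrollWeight])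

theorem scrollPart_zero_one_one_le {W : Submodule K (MvPolynomial (Fin 6) K)} (h0 : X 0 ∈ W)
    (h13 : X 1 * X 3 ∈ W) (h23 : X 2 * X 3 ∈ W) (h14 : X 1 * X 4 ∈ W) (h24 : X 2 * X 4 ∈ W)
    (h5 : X 5 ∈ W) : scrollPart K ![0, 1, 1] 1 ≤ W := by
  have key : ∀ r s : ℕ, r + s = 1 → (r = 0 ∧ s = 1) ∨ (r = 1 ∧ s = 0) := by omega
  refine scrollPart_one_le (fun r s h => ?_) (fun r s h => ?_) (fun r s h => ?_) h5
  · obtain ⟨rfl, rfl⟩ : r = 0 ∧ s = 0 := by simpa using h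
    simpa using h0
  · obtain ⟨rfl, rfl⟩ | ⟨rfl, rfl⟩ := key r s h
    · simpa using h23
    · simpa using h13
  · obtain ⟨rfl, rfl⟩ | ⟨rfl, rfl⟩ := key r s h
    · simpa using h24
    · simpa using h14

theorem scrollPart_one_one_two_le {W : Submodule K (MvPolynomial (Fin 6) K)}
    (h10 : X 1 * X 0 ∈ W) (h20 : X 2 * X 0 ∈ W) (h13 : X 1 * X 3 ∈ W) (h23 : X 2 * X 3 ∈ W)
    (h114 : X 1 ^ 2 * X 4 ∈ W) (h124 : X 1 * X 2 * X 4 ∈ W) (h224 : X 2 ^ 2 * X 4 ∈ W)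
    (h5 : X 5 ∈ W) : scrollPart K ![1, 1, 2] 1 ≤ W := by
  have key : ∀ r s : ℕ, r + s = 1 → (r = 0 ∧ s = 1) ∨ (r = 1 ∧ s = 0) := by omega
  refine scrollPart_one_le (fun r s h => ?_) (fun r s h => ?_) (fun r s h => ?_) h5
  · obtain ⟨rfl, rfl⟩ | ⟨rfl, rfl⟩ := key r s h
    · simpa using h20
    · simpa using h10
  · obtain ⟨rfl, rfl⟩ | ⟨rfl, rfl⟩ := key r s h
    · simpa using h23
    · simpa using h13
  · have h : r + s = 2 := h
    obtain ⟨rfl, rfl⟩ | ⟨rfl, rfl⟩ | ⟨rfl, rfl⟩ :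
      (r = 0 ∧ s = 2) ∨ (r = 1 ∧ s = 1) ∨ (r = 2 ∧ s = 0) := by omega
    · simpa using h224
    · simpa using h124
    · simpa using h114

theorem quadricFour_mem (b : K) : quadricFour b ∈ scrollPart K ![0, 1, 1] 2 := by
  obtain ⟨h0, h13, h23, h14, h24, -⟩ := mem_scrollPart_zero_one_one (K := K)
  have : quadricFour b = C (1 - b ^ 2) * (X 0 * X 0) - (X 1 * X 3) * (X 1 * X 3) +
      (X 1 * X 4) * (X 1 * X 4) + (X 2 * X 3) * (X 2 * X 3) - (X 2 * X 4) * (X 2 * X 4) := by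
    simp only [quadricFour]; ring
  rw [this]
  exact sub_mem (add_mem (add_mem (sub_mem (C_mul_mem (mul_mem_scrollPart_two h0 h0) _)
    (mul_mem_scrollPart_two h13 h13)) (mul_mem_scrollPart_two h14 h14))
    (mul_mem_scrollPart_two h23 h23)) (mul_mem_scrollPart_two h24 h24)

theorem quadricEight_mem (b : K) : quadricEight b ∈ scrollPart K ![1, 1, 2] 2 := by
  obtain ⟨h10, h20, h13, h23, h114, h124, h224, -⟩ := mem_scrollPart_one_one_two (K := K)
  have : quadricEight b = (X 1 * X 0) * (X 1 * X 0) - (X 2 * X 0) * (X 2 * X 0) -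
      (X 1 * X 3) * (X 1 * X 3) + C (b ^ 2) * ((X 2 * X 3) * (X 2 * X 3)) -
      C (1 - b ^ 2) * ((X 1 ^ 2 * X 4 - X 2 ^ 2 * X 4) *
        (X 1 ^ 2 * X 4 - C (b ^ 2) * (X 2 ^ 2 * X 4))) := by
    simp only [quadricEight]; ring
  rw [this]
  exact sub_mem (add_mem (sub_mem (sub_mem (mul_mem_scrollPart_two h10 h10)
    (mul_mem_scrollPart_two h20 h20)) (mul_mem_scrollPart_two h13 h13))
    (C_mul_mem (mul_mem_scrollPart_two h23 h23) _))
    (C_mul_mem (mul_mem_scrollPart_two (sub_mem h114 h224)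
      (sub_mem h114 (C_mul_mem h224 _))) _)

/-- The polynomials whose residue class modulo `g` is algebraic over the classes of `ξ`. -/
noncomputable def algebraicPart (g : MvPolynomial (Fin 6) K) [(Ideal.span {g}).IsPrime]
    {n : ℕ} (ξ : Fin n → MvPolynomial (Fin 6) K) : Subalgebra K (MvPolynomial (Fin 6) K) :=
  ((Subalgebra.algebraicClosure (Algebra.adjoin K
    (Set.range fun i => Ideal.Quotient.mk (Ideal.span {g}) (ξ i))) _).restrictScalars K).comap
      (Ideal.Quotient.mkₐ K (Ideal.span {g}))

section

variable {g : MvPolynomial (Fin 6) K} [(Ideal.span {g}).IsPrime] {n : ℕ}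
  {ξ : Fin n → MvPolynomial (Fin 6) K}

theorem mem_algebraicPart {f : MvPolynomial (Fin 6) K} : f ∈ algebraicPart g ξ ↔
    IsAlgebraic (Algebra.adjoin K (Set.range fun i => Ideal.Quotient.mk (Ideal.span {g}) (ξ i)))
      (Ideal.Quotient.mk (Ideal.span {g}) f) := Iff.rfl

theorem gen_mem_algebraicPart (i : Fin n) : ξ i ∈ algebraicPart g ξ :=
  mem_algebraicPart.2 <| isAlgebraic_algebraMap
    (⟨_, Algebra.subset_adjoin ⟨i, rfl⟩⟩ : Algebra.adjoin K
      (Set.range fun i => Ideal.Quotient.mk (Ideal.span {g}) (ξ i)))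

/-- Division: modulo `g`, `h` is a quotient of algebraic elements, and the point `w` certifies that
the denominator is nonzero. -/
theorem mem_algebraicPart_of_mul {f h k : MvPolynomial (Fin 6) K} (hf : f ∈ algebraicPart g ξ)
    (w : Fin 6 → K) (hw : eval w g = 0) (hwf : eval w f ≠ 0)
    (hk : k ∈ algebraicPart g ξ) (heq : g ∣ f * h - k) : h ∈ algebraicPart g ξ := by
  rw [mem_algebraicPart] at *
  have hfh : Ideal.Quotient.mk (Ideal.span {g}) (f * h) = Ideal.Quotient.mk _ k :=
    Ideal.Quotient.eq.2 (Ideal.mem_span_singleton.2 heq)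
  rw [← hfh, map_mul] at hk
  refine IsAlgebraic.of_mul (mem_nonZeroDivisors_of_ne_zero fun h0 => ?_) hf hk
  rw [Ideal.Quotient.eq_zero_iff_mem, Ideal.mem_span_singleton] at h0
  exact MvPolynomial.not_dvd_of_eval w hw hwf h0

theorem mem_algebraicPart_of_sq {f : MvPolynomial (Fin 6) K}
    (hf : f ^ 2 ∈ algebraicPart g ξ) : f ∈ algebraicPart g ξ := by
  rw [mem_algebraicPart, map_pow] at hf
  exact hf.of_pow two_pos

theorem C_mul_mem_algebraicPart {f : MvPolynomial (Fin 6) K} (hf : f ∈ algebraicPart g ξ)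
    (c : K) : C c * f ∈ algebraicPart g ξ :=
  mul_mem ((algebraicPart g ξ).algebraMap_mem c) hf

end

end

namespace ProjVar.IsScrollSection

variable {K : Type*} [Field K] [IsAlgClosed K] {b : K} {σ : Type*} [Finite σ]
  {Φ : MvPolynomial σ K →ₐ[K] MvPolynomial (Fin 6) K} {s : Set (MvPolynomial σ K)}

theorem hasDim_three_of_quadricFour (hb1 : b ^ 2 ≠ 1)
    (h : IsScrollSection ![0, 1, 1] (quadricFour b) Φ s) : HasDim (zeroLocus s) 3 := by
  have hb : 1 - b ^ 2 ≠ 0 := sub_ne_zero.2 hb1.symm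
  have := h.isPrime_span
  obtain ⟨-, h13, h23, -, h24, h5⟩ := mem_scrollPart_zero_one_one (K := K)
  set ξ : Fin 4 → MvPolynomial (Fin 6) K := ![X 1 * X 3, X 2 * X 3, X 2 * X 4, X 5] with hξ
  refine h.hasDim ξ (fun i => ?_) ⟨X 1, X_ne_zero _, fun x hx => ?_⟩ ?_
  · fin_cases i
    exacts [h13, h23, h24, h5]
  · rw [eval_X] at hx
    -- With the base point `(x 0 / x 1 : 1)`, the values of `ξ` fix the variables `3, 4, 5`, and `g
    -- = 0` is solved for the square of the variable `0`.
    obtain ⟨p, hp⟩ := IsAlgClosed.exists_pow_nat_eq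
      (((x 0 / x 1) ^ 2 - 1) * (x 1 ^ 2 - x 2 ^ 2) / (1 - b ^ 2)) two_pos
    refine ⟨![p, x 0 / x 1, 1, x 1, x 2, x 3], ?_, fun i => ?_⟩
    · simp [quadricFour, hp]
      field_simp
      ring
    · fin_cases i <;> simp [hξ, hx]
  · have g0 : X 1 * X 3 ∈ algebraicPart (quadricFour b) ξ := gen_mem_algebraicPart 0
    have g1 : X 2 * X 3 ∈ algebraicPart (quadricFour b) ξ := gen_mem_algebraicPart 1
    have g2 : X 2 * X 4 ∈ algebraicPart (quadricFour b) ξ := gen_mem_algebraicPart 2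
    have g3 : X 5 ∈ algebraicPart (quadricFour b) ξ := gen_mem_algebraicPart 3
    have g4 : X 1 * X 4 ∈ algebraicPart (quadricFour b) ξ := by
      refine mem_algebraicPart_of_mul g1 ![0, 1, 1, 1, 0, 0] (by simp [quadricFour]) (by simp)
        (mul_mem g0 g2) ⟨0, by ring⟩
    have g5 : X 0 ∈ algebraicPart (quadricFour b) ξ := by
      refine mem_algebraicPart_of_sq (mem_algebraicPart_of_mul
        (C_mul_mem_algebraicPart (one_mem _) (1 - b ^ 2)) ![0, 1, 1, 1, 0, 0]
        (by simp [quadricFour]) (by simpa using hb)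
        (sub_mem (add_mem (sub_mem (pow_mem g0 2) (pow_mem g4 2)) (pow_mem g2 2))
          (pow_mem g1 2)) ⟨1, ?_⟩)
      rw [quadricFour]
      ring
    exact scrollPart_zero_one_one_le (W := Subalgebra.toSubmodule (algebraicPart _ ξ))
      g5 g0 g1 g4 g2 g3

theorem hasDim_three_of_quadricEight (hb1 : b ^ 2 ≠ 1)
    (h : IsScrollSection ![1, 1, 2] (quadricEight b) Φ s) : HasDim (zeroLocus s) 3 := by
  have hb : 1 - b ^ 2 ≠ 0 := sub_ne_zero.2 hb1.symm
  have := h.isPrime_span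
  obtain ⟨h10, h20, -, -, -, h124, -, h5⟩ := mem_scrollPart_one_one_two (K := K)
  set ξ : Fin 4 → MvPolynomial (Fin 6) K := ![X 1 * X 0, X 2 * X 0, X 1 * X 2 * X 4, X 5] with hξ
  refine h.hasDim ξ (fun i => ?_) ⟨X 0 * X 1 * (X 0 ^ 2 - C (b ^ 2) * X 1 ^ 2), ?_,
    fun x hx => ?_⟩ ?_
  · fin_cases i
    exacts [h10, h20, h124, h5]
  · intro h0
    have := congrArg (eval ![1, 1, 0, 0]) h0
    simp at this
    exact hb this
  · simp only [map_mul, map_sub, map_pow, eval_X, eval_C] at hx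
    have hx0 : x 0 ≠ 0 := fun h => hx (by rw [h]; ring)
    have hx1 : x 1 ≠ 0 := fun h => hx (by rw [h]; ring)
    have hx2 : x 0 ^ 2 - b ^ 2 * x 1 ^ 2 ≠ 0 := fun h => hx (by rw [h]; ring)
    -- With the base point `(x 0 / x 1 : 1)`, `g = 0` is solved for the square of the variable `3`,
    -- whose coefficient is nonzero because `x 0 ^ 2 ≠ b ^ 2 * x 1 ^ 2`.
    obtain ⟨z, hz⟩ := IsAlgClosed.exists_pow_nat_eq
      (((x 0 / x 1) ^ 2 - 1) * x 1 ^ 2 / ((x 0 / x 1) ^ 2 - b ^ 2) -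
        (1 - b ^ 2) * ((x 0 / x 1) ^ 2 - 1) * (x 2 / (x 0 / x 1)) ^ 2) two_pos
    have hx3 : (x 0 / x 1) ^ 2 - b ^ 2 ≠ 0 := by
      intro h
      apply hx2
      field_simp at h
      linear_combination h
    refine ⟨![x 1, x 0 / x 1, 1, z, x 2 / (x 0 / x 1), x 3], ?_, fun i => ?_⟩
    · simp only [quadricEight, map_mul, map_sub, map_pow, map_add, eval_X, eval_C]
      simp [hz]
      rw [mul_div_cancel₀ _ hx3]
      ring
    · fin_cases i <;> simp [hξ] <;> field_simp
  · have g0 : X 1 * X 0 ∈ algebraicPart (quadricEight b) ξ := gen_mem_algebraicPart 0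
    have g1 : X 2 * X 0 ∈ algebraicPart (quadricEight b) ξ := gen_mem_algebraicPart 1
    have g2 : X 1 * X 2 * X 4 ∈ algebraicPart (quadricEight b) ξ := gen_mem_algebraicPart 2
    have g3 : X 5 ∈ algebraicPart (quadricEight b) ξ := gen_mem_algebraicPart 3
    have hw : eval ![1, 1, 1, 0, 0, 0] (quadricEight b) = 0 := by simp [quadricEight]
    have g4 : X 1 ^ 2 * X 4 ∈ algebraicPart (quadricEight b) ξ :=
      mem_algebraicPart_of_mul g1 _ hw (by simp) (mul_mem g0 g2) ⟨0, by ring⟩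
    have g5 : X 2 ^ 2 * X 4 ∈ algebraicPart (quadricEight b) ξ :=
      mem_algebraicPart_of_mul g0 _ hw (by simp) (mul_mem g1 g2) ⟨0, by ring⟩
    -- The equation `g = 0` times `X 2 ^ 2 * X 0 ^ 2` gives `(X 2 * X 3) ^ 2` as a quotient of
    -- elements already known to be algebraic.
    have g6 : X 2 * X 3 ∈ algebraicPart (quadricEight b) ξ := by
      refine mem_algebraicPart_of_sq (mem_algebraicPart_of_mul
        (sub_mem (pow_mem g0 2) (C_mul_mem_algebraicPart (pow_mem g1 2) (b ^ 2)))
        _ hw (by simpa using hb) (mul_mem (pow_mem g1 2)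
          (sub_mem (sub_mem (pow_mem g0 2) (pow_mem g1 2))
            (C_mul_mem_algebraicPart (mul_mem (sub_mem g4 g5)
              (sub_mem g4 (C_mul_mem_algebraicPart g5 (b ^ 2)))) (1 - b ^ 2))))
        ⟨-(X 2 ^ 2 * X 0 ^ 2), ?_⟩)
      rw [quadricEight]
      ring
    have g7 : X 1 * X 3 ∈ algebraicPart (quadricEight b) ξ :=
      mem_algebraicPart_of_mul g1 _ hw (by simp) (mul_mem g0 g6) ⟨0, by ring⟩
    exact scrollPart_one_one_two_le (W := Subalgebra.toSubmodule (algebraicPart _ ξ))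
      g0 g1 g7 g6 g4 g2 g5 g3

end ProjVar.IsScrollSection

/-! ### Adapted linear coordinates -/

namespace VarietyV

variable {K : Type*} [Field K]

/-- Linear forms adapted to the variety: the pairwise sums of the `W i`, and, for
`Z i = τ i * Y i`, the differences and the sums of `Z 0, Z 2` and of `Z 1, Z 3`. -/
noncomputable def coord (τ : Fin 4 → K) : Fin 7 → MvPolynomial (Fin 8) K :=
  ![X 0 + X 1, X 1 + X 2, X 0 + X 2, C (τ 0) * X 4 - C (τ 2) * X 6,
    C (τ 1) * X 5 - C (τ 3) * X 7, C (τ 0) * X 4 + C (τ 2) * X 6, C (τ 1) * X 5 + C (τ 3) * X 7]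

/-- The values of the forms `coord τ`. -/
def coordVal (τ : Fin 4 → K) (v : Fin 8 → K) : Fin 7 → K :=
  ![v 0 + v 1, v 1 + v 2, v 0 + v 2, τ 0 * v 4 - τ 2 * v 6, τ 1 * v 5 - τ 3 * v 7,
    τ 0 * v 4 + τ 2 * v 6, τ 1 * v 5 + τ 3 * v 7]

theorem eval_coord (τ : Fin 4 → K) (v : Fin 8 → K) (i : Fin 7) :
    eval v (coord τ i) = coordVal τ v i := by
  fin_cases i <;> simp [coord, coordVal]

theorem isHomogeneous_coord (τ : Fin 4 → K) (i : Fin 7) : (coord τ i).IsHomogeneous 1 := by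
  have hC : ∀ (c : K) (j : Fin 8), (C c * X j : MvPolynomial (Fin 8) K).IsHomogeneous 1 :=
    fun c j => by simpa using (isHomogeneous_C (Fin 8) c).mul (isHomogeneous_X K j)
  have hX : ∀ j : Fin 8, (X j : MvPolynomial (Fin 8) K).IsHomogeneous 1 := isHomogeneous_X K
  fin_cases i
  exacts [(hX 0).add (hX 1), (hX 1).add (hX 2), (hX 0).add (hX 2), (hC _ 4).sub (hC _ 6),
    (hC _ 5).sub (hC _ 7), (hC _ 4).add (hC _ 6), (hC _ 5).add (hC _ 7)]

theorem ext_coordVal {τ : Fin 4 → K} (h2 : (2 : K) ≠ 0) (hτ : ∀ i, τ i ≠ 0) {v v' : Fin 8 → K}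
    (h : coordVal τ v = coordVal τ v') (h3 : v 3 = v' 3) : v = v' := by
  have e := fun i => congrFun h i
  have e0 : v 0 + v 1 = v' 0 + v' 1 := e 0
  have e1 : v 1 + v 2 = v' 1 + v' 2 := e 1
  have e2 : v 0 + v 2 = v' 0 + v' 2 := e 2
  have e3 : τ 0 * v 4 - τ 2 * v 6 = τ 0 * v' 4 - τ 2 * v' 6 := e 3
  have e4 : τ 1 * v 5 - τ 3 * v 7 = τ 1 * v' 5 - τ 3 * v' 7 := e 4
  have e5 : τ 0 * v 4 + τ 2 * v 6 = τ 0 * v' 4 + τ 2 * v' 6 := e 5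
  have e6 : τ 1 * v 5 + τ 3 * v 7 = τ 1 * v' 5 + τ 3 * v' 7 := e 6
  have c := fun i => mul_ne_zero h2 (hτ i)
  funext i
  fin_cases i
  · exact mul_left_cancel₀ h2 (show 2 * v 0 = 2 * v' 0 by
      linear_combination e0 - e1 + e2)
  · exact mul_left_cancel₀ h2 (show 2 * v 1 = 2 * v' 1 by
      linear_combination e0 + e1 - e2)
  · exact mul_left_cancel₀ h2 (show 2 * v 2 = 2 * v' 2 by
      linear_combination e1 + e2 - e0)
  · exact h3
  · exact mul_left_cancel₀ (c 0) (show 2 * τ 0 * v 4 = 2 * τ 0 * v' 4 by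
      linear_combination e3 + e5)
  · exact mul_left_cancel₀ (c 1) (show 2 * τ 1 * v 5 = 2 * τ 1 * v' 5 by
      linear_combination e4 + e6)
  · exact mul_left_cancel₀ (c 2) (show 2 * τ 2 * v 6 = 2 * τ 2 * v' 6 by
      linear_combination e5 - e3)
  · exact mul_left_cancel₀ (c 3) (show 2 * τ 3 * v 7 = 2 * τ 3 * v' 7 by
      linear_combination e6 - e4)

/-- The substitution making the form `coord τ i` equal to `2 * F i`. -/
noncomputable def embed (τ : Fin 4 → K) (F : Fin 7 → MvPolynomial (Fin 6) K) :
    MvPolynomial (Fin 8) K →ₐ[K] MvPolynomial (Fin 6) K :=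
  aeval ![F 0 + F 2 - F 1, F 0 + F 1 - F 2, F 1 + F 2 - F 0, X 5, C (τ 0)⁻¹ * (F 5 + F 3),
    C (τ 1)⁻¹ * (F 6 + F 4), C (τ 2)⁻¹ * (F 5 - F 3), C (τ 3)⁻¹ * (F 6 - F 4)]

theorem embed_coord {τ : Fin 4 → K} (hτ : ∀ i, τ i ≠ 0) (F : Fin 7 → MvPolynomial (Fin 6) K)
    (i : Fin 7) : embed τ F (coord τ i) = 2 * F i := by
  have hC : ∀ j f, (C (τ j) * (C (τ j)⁻¹ * f) : MvPolynomial (Fin 6) K) = f := fun j f => by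
    rw [← mul_assoc, ← C_mul, mul_inv_cancel₀ (hτ j), C_1, one_mul]
  fin_cases i <;> simp [coord, embed, algebraMap_eq, hC] <;> ring

theorem span_embed {τ : Fin 4 → K} (h2 : (2 : K) ≠ 0) (hτ : ∀ i, τ i ≠ 0) {a : Fin 3 → ℕ}
    {F : Fin 7 → MvPolynomial (Fin 6) K} (hF : ∀ i, F i ∈ scrollPart K a 1)
    (h5 : X 5 ∈ scrollPart K a 1)
    (hspan : ∀ W : Submodule K (MvPolynomial (Fin 6) K), (∀ i, F i ∈ W) → X 5 ∈ W →
      scrollPart K a 1 ≤ W) :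
    Submodule.span K (Set.range fun i => embed τ F (X i)) = scrollPart K a 1 := by
  refine le_antisymm (Submodule.span_le.2 ?_) (hspan _ (fun i => ?_) ?_)
  · rintro _ ⟨i, rfl⟩
    simp only [embed, aeval_X, SetLike.mem_coe]
    fin_cases i
    exacts [sub_mem (add_mem (hF 0) (hF 2)) (hF 1), sub_mem (add_mem (hF 0) (hF 1)) (hF 2),
      sub_mem (add_mem (hF 1) (hF 2)) (hF 0), h5, C_mul_mem (add_mem (hF 5) (hF 3)) _,
      C_mul_mem (add_mem (hF 6) (hF 4)) _, C_mul_mem (sub_mem (hF 5) (hF 3)) _,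
      C_mul_mem (sub_mem (hF 6) (hF 4)) _]
  · have h1 : coord τ i ∈ Submodule.span K (Set.range X) := by
      rw [← homogeneousSubmodule_one_eq_span_X]
      exact isHomogeneous_coord τ i
    have h3 := Submodule.mem_map_of_mem (f := (embed τ F).toLinearMap) h1
    rw [Submodule.map_span, ← Set.range_comp, AlgHom.toLinearMap_apply, embed_coord hτ] at h3
    have h4 := C_mul_mem h3 (2 : K)⁻¹
    rwa [← mul_assoc, show (2 : MvPolynomial (Fin 6) K) = C 2 from (map_ofNat C 2).symm, ← C_mul,
      inv_mul_cancel₀ h2, C_1, one_mul] at h4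
  · exact Submodule.subset_span ⟨3, by simp [embed]⟩

theorem eq_eval_embed_iff {τ : Fin 4 → K} (h2 : (2 : K) ≠ 0) (hτ : ∀ i, τ i ≠ 0)
    (F : Fin 7 → MvPolynomial (Fin 6) K) (v : Fin 8 → K) (w : Fin 6 → K) :
    (v = fun i => eval w (embed τ F (X i))) ↔
      (∀ i, coordVal τ v i = 2 * eval w (F i)) ∧ v 3 = w 5 := by
  have key : ∀ i, coordVal τ (fun i => eval w (embed τ F (X i))) i = 2 * eval w (F i) := by
    intro i
    rw [← eval_coord, ← ProjVar.IsScrollSection.eval_apply, embed_coord hτ]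
    simp
  have key3 : eval w (embed τ F (X 3)) = w 5 := by simp [embed]
  constructor
  · rintro rfl
    exact ⟨key, key3⟩
  · rintro ⟨h, h3⟩
    exact ext_coordVal h2 hτ (funext fun i => (h i).trans (key i).symm) (h3.trans key3.symm)

/-- The columns of a two-row matrix with vanishing minors are multiples of one nonzero column `(u,
v)`, which for the zero matrix is arbitrary. -/
theorem exists_rank_one {ι : Type*} (x y : ι → K) (h : ∀ i j, x i * y j = x j * y i) :
    ∃ u v : K, (u ≠ 0 ∨ v ≠ 0) ∧ ∀ i, ∃ c, x i = u * c ∧ y i = v * c := by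
  by_cases h0 : ∃ i, x i ≠ 0 ∨ y i ≠ 0
  · obtain ⟨i, hi⟩ := h0
    refine ⟨x i, y i, hi, fun j => ?_⟩
    rcases hi with hi | hi
    · exact ⟨x j / x i, by field_simp, by field_simp; linear_combination h i j⟩
    · exact ⟨y j / y i, by field_simp; linear_combination -h i j, by field_simp⟩
  · push Not at h0
    exact ⟨1, 0, Or.inl one_ne_zero, fun i => ⟨0, by simp [h0 i], by simp [h0 i]⟩⟩

/-- The quadratic equation shared by all components. -/
noncomputable def quadric (τ : Fin 4 → K) (b : K) : MvPolynomial (Fin 8) K :=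
  coord τ 0 * coord τ 0 + coord τ 1 * coord τ 1 + coord τ 2 * coord τ 2 -
    (coord τ 3 * coord τ 3 + coord τ 4 * coord τ 4 +
      coord τ 5 * (coord τ 5 - C b * coord τ 6) + coord τ 6 * (coord τ 6 - C b * coord τ 5))

end VarietyV

/-! ### Equations and parametrizations of the three components -/

namespace VarietyV

variable {K : Type*} [Field K]

/-- Equations of the first component of degree four. -/
def eqsFour₁ (τ : Fin 4 → K) (b : K) : Set (MvPolynomial (Fin 8) K) :=
  {coord τ 0, coord τ 3, coord τ 1 * coord τ 2 - coord τ 4 * (C b * coord τ 5 - coord τ 6),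
    quadric τ b}

/-- Equations of the second component of degree four. -/
def eqsFour₂ (τ : Fin 4 → K) (b : K) : Set (MvPolynomial (Fin 8) K) :=
  {coord τ 1, coord τ 4, coord τ 0 * coord τ 2 - coord τ 3 * (coord τ 5 - C b * coord τ 6),
    quadric τ b}

/-- Equations of the component of degree eight. -/
def eqsEight (τ : Fin 4 → K) (b : K) : Set (MvPolynomial (Fin 8) K) :=
  {coord τ 0 * coord τ 1 - C b * (coord τ 3 * coord τ 4),
    coord τ 0 * coord τ 2 - coord τ 3 * (coord τ 5 - C b * coord τ 6),
    coord τ 0 * (C b * coord τ 5 - coord τ 6) - C b * (coord τ 2 * coord τ 3),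
    C b * (coord τ 4 * coord τ 2) - coord τ 1 * (coord τ 5 - C b * coord τ 6),
    coord τ 1 * coord τ 2 - coord τ 4 * (C b * coord τ 5 - coord τ 6),
    (coord τ 5 - C b * coord τ 6) * (C b * coord τ 5 - coord τ 6) -
      C b * (coord τ 2 * coord τ 2), quadric τ b}

/-- The value of `quadric τ b` in terms of the coordinates. -/
def quadricVal (b : K) (c : Fin 7 → K) : K :=
  c 0 * c 0 + c 1 * c 1 + c 2 * c 2 - (c 3 * c 3 + c 4 * c 4 + c 5 * (c 5 - b * c 6) +
    c 6 * (c 6 - b * c 5))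

theorem forall_eqsFour₁_iff (τ : Fin 4 → K) (b : K) (v : Fin 8 → K) :
    (∀ f ∈ eqsFour₁ τ b, eval v f = 0) ↔ ∀ c, c = coordVal τ v → c 0 = 0 ∧ c 3 = 0 ∧
      c 1 * c 2 - c 4 * (b * c 5 - c 6) = 0 ∧ quadricVal b c = 0 := by
  simp [eqsFour₁, quadric, quadricVal, eval_coord]

theorem forall_eqsFour₂_iff (τ : Fin 4 → K) (b : K) (v : Fin 8 → K) :
    (∀ f ∈ eqsFour₂ τ b, eval v f = 0) ↔ ∀ c, c = coordVal τ v → c 1 = 0 ∧ c 4 = 0 ∧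
      c 0 * c 2 - c 3 * (c 5 - b * c 6) = 0 ∧ quadricVal b c = 0 := by
  simp [eqsFour₂, quadric, quadricVal, eval_coord]

theorem forall_eqsEight_iff (τ : Fin 4 → K) (b : K) (v : Fin 8 → K) :
    (∀ f ∈ eqsEight τ b, eval v f = 0) ↔ ∀ c, c = coordVal τ v →
      c 0 * c 1 - b * (c 3 * c 4) = 0 ∧ c 0 * c 2 - c 3 * (c 5 - b * c 6) = 0 ∧
      c 0 * (b * c 5 - c 6) - b * (c 2 * c 3) = 0 ∧
      b * (c 4 * c 2) - c 1 * (c 5 - b * c 6) = 0 ∧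
      c 1 * c 2 - c 4 * (b * c 5 - c 6) = 0 ∧
      (c 5 - b * c 6) * (b * c 5 - c 6) - b * (c 2 * c 2) = 0 ∧ quadricVal b c = 0 := by
  simp [eqsEight, quadric, quadricVal, eval_coord]

section homogeneous

variable (τ : Fin 4 → K) (b : K)

theorem isHomogeneous_C_mul {σ : Type*} {f : MvPolynomial σ K} {n : ℕ} (hf : f.IsHomogeneous n)
    (c : K) : (C c * f).IsHomogeneous n := by
  simpa using (isHomogeneous_C σ c).mul hf

theorem isHomogeneous_coord_mul (i j : Fin 7) : (coord τ i * coord τ j).IsHomogeneous 2 :=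
  (isHomogeneous_coord τ i).mul (isHomogeneous_coord τ j)

theorem isHomogeneous_quadric : (quadric τ b).IsHomogeneous 2 := by
  have h := isHomogeneous_coord τ
  have hh := isHomogeneous_coord_mul τ
  exact (((hh 0 0).add (hh 1 1)).add (hh 2 2)).sub ((((hh 3 3).add (hh 4 4)).add
    ((h 5).mul ((h 5).sub (isHomogeneous_C_mul (h 6) b)))).add
    ((h 6).mul ((h 6).sub (isHomogeneous_C_mul (h 5) b))))

theorem isHomogeneous_eqsFour₁ : ∀ f ∈ eqsFour₁ τ b, ∃ d, f.IsHomogeneous d := by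
  have h := isHomogeneous_coord τ
  have hh := isHomogeneous_coord_mul τ
  have hm := (isHomogeneous_C_mul (h 5) b).sub (h 6)
  rintro f (rfl | rfl | rfl | rfl)
  exacts [⟨1, h 0⟩, ⟨1, h 3⟩, ⟨2, (hh 1 2).sub ((h 4).mul hm)⟩, ⟨2, isHomogeneous_quadric τ b⟩]

theorem isHomogeneous_eqsFour₂ : ∀ f ∈ eqsFour₂ τ b, ∃ d, f.IsHomogeneous d := by
  have h := isHomogeneous_coord τ
  have hh := isHomogeneous_coord_mul τ
  have hp := (h 5).sub (isHomogeneous_C_mul (h 6) b)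
  rintro f (rfl | rfl | rfl | rfl)
  exacts [⟨1, h 1⟩, ⟨1, h 4⟩, ⟨2, (hh 0 2).sub ((h 3).mul hp)⟩, ⟨2, isHomogeneous_quadric τ b⟩]

theorem isHomogeneous_eqsEight : ∀ f ∈ eqsEight τ b, ∃ d, f.IsHomogeneous d := by
  have h := isHomogeneous_coord τ
  have hh := isHomogeneous_coord_mul τ
  have hp := (h 5).sub (isHomogeneous_C_mul (h 6) b)
  have hm := (isHomogeneous_C_mul (h 5) b).sub (h 6)
  have hC := fun i j => isHomogeneous_C_mul (hh i j) b
  rintro f (rfl | rfl | rfl | rfl | rfl | rfl | rfl)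
  exacts [⟨2, (hh 0 1).sub (hC 3 4)⟩, ⟨2, (hh 0 2).sub ((h 3).mul hp)⟩,
    ⟨2, ((h 0).mul hm).sub (hC 2 3)⟩, ⟨2, (hC 4 2).sub ((h 1).mul hp)⟩,
    ⟨2, (hh 1 2).sub ((h 4).mul hm)⟩, ⟨2, (hp.mul hm).sub (hC 2 2)⟩,
    ⟨2, isHomogeneous_quadric τ b⟩]

end homogeneous

/-- Parametrization of the first component of degree four. -/
noncomputable def paramFour₁ (b : K) : Fin 7 → MvPolynomial (Fin 6) K :=
  ![0, X 1 * X 3, X 2 * X 4, 0, X 2 * X 3, X 0, C b * X 0 - X 1 * X 4]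

/-- Parametrization of the second component of degree four. -/
noncomputable def paramFour₂ (b : K) : Fin 7 → MvPolynomial (Fin 6) K :=
  ![X 1 * X 3, 0, X 2 * X 4, X 2 * X 3, 0, X 1 * X 4 + C b * X 0, X 0]

/-- Parametrization of the component of degree eight. -/
noncomputable def paramEight (b : K) : Fin 7 → MvPolynomial (Fin 6) K :=
  ![X 1 * X 0, C b * (X 2 * X 3), C (1 - b ^ 2) * (X 1 * X 2 * X 4), X 2 * X 0, X 1 * X 3,
    X 1 ^ 2 * X 4 - C (b ^ 2) * (X 2 ^ 2 * X 4), C b * (X 1 ^ 2 * X 4 - X 2 ^ 2 * X 4)]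

section param

variable {b : K}

theorem span_paramFour₁ {τ : Fin 4 → K} (h2 : (2 : K) ≠ 0) (hτ : ∀ i, τ i ≠ 0) :
    Submodule.span K (Set.range fun i => embed τ (paramFour₁ b) (X i)) =
      scrollPart K ![0, 1, 1] 1 := by
  obtain ⟨h0, h13, h23, h14, h24, h5⟩ := mem_scrollPart_zero_one_one (K := K)
  refine span_embed h2 hτ (fun i => ?_) h5 fun W hW hW5 => ?_
  · fin_cases i
    exacts [zero_mem _, h13, h24, zero_mem _, h23, h0, sub_mem (C_mul_mem h0 b) h14]
  · have e5 : X 0 ∈ W := hW 5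
    have e6 : C b * X 0 - X 1 * X 4 ∈ W := hW 6
    exact scrollPart_zero_one_one_le e5 (hW 1) (hW 4)
      (by simpa using sub_mem (C_mul_mem e5 b) e6) (hW 2) hW5

theorem span_paramFour₂ {τ : Fin 4 → K} (h2 : (2 : K) ≠ 0) (hτ : ∀ i, τ i ≠ 0) :
    Submodule.span K (Set.range fun i => embed τ (paramFour₂ b) (X i)) =
      scrollPart K ![0, 1, 1] 1 := by
  obtain ⟨h0, h13, h23, h14, h24, h5⟩ := mem_scrollPart_zero_one_one (K := K)
  refine span_embed h2 hτ (fun i => ?_) h5 fun W hW hW5 => ?_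
  · fin_cases i
    exacts [h13, zero_mem _, h24, h23, zero_mem _, add_mem h14 (C_mul_mem h0 b), h0]
  · have e6 : X 0 ∈ W := hW 6
    have e5 : X 1 * X 4 + C b * X 0 ∈ W := hW 5
    exact scrollPart_zero_one_one_le e6 (hW 0) (hW 3)
      (by simpa using sub_mem e5 (C_mul_mem e6 b)) (hW 2) hW5

theorem mem_of_C_mul_mem {W : Submodule K (MvPolynomial (Fin 6) K)} {f : MvPolynomial (Fin 6) K}
    {c : K} (hc : c ≠ 0) (h : C c * f ∈ W) : f ∈ W := by
  have := C_mul_mem h c⁻¹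
  rwa [← mul_assoc, ← C_mul, inv_mul_cancel₀ hc, C_1, one_mul] at this

theorem span_paramEight {τ : Fin 4 → K} (h2 : (2 : K) ≠ 0) (hτ : ∀ i, τ i ≠ 0) (hb0 : b ≠ 0)
    (hb1 : b ^ 2 ≠ 1) : Submodule.span K (Set.range fun i => embed τ (paramEight b) (X i)) =
      scrollPart K ![1, 1, 2] 1 := by
  have hb : 1 - b ^ 2 ≠ 0 := sub_ne_zero.2 hb1.symm
  obtain ⟨h10, h20, h13, h23, h114, h124, h224, h5⟩ := mem_scrollPart_one_one_two (K := K)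
  refine span_embed h2 hτ (fun i => ?_) h5 fun W hW hW5 => ?_
  · fin_cases i
    exacts [h10, C_mul_mem h23 b, C_mul_mem h124 _, h20, h13, sub_mem h114 (C_mul_mem h224 _),
      C_mul_mem (sub_mem h114 h224) _]
  · have e5 : X 1 ^ 2 * X 4 - C (b ^ 2) * (X 2 ^ 2 * X 4) ∈ W := hW 5
    have e6 : X 1 ^ 2 * X 4 - X 2 ^ 2 * X 4 ∈ W := mem_of_C_mul_mem hb0 (hW 6)
    refine scrollPart_one_one_two_le (hW 0) (hW 3) (hW 4) (mem_of_C_mul_mem hb0 (hW 1)) ?_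
      (mem_of_C_mul_mem hb (hW 2)) ?_ hW5
    · refine mem_of_C_mul_mem hb ?_
      convert sub_mem e5 (C_mul_mem e6 (b ^ 2)) using 1
      simp only [C_sub, C_1]
      ring
    · refine mem_of_C_mul_mem hb ?_
      convert sub_mem e5 e6 using 1
      simp only [C_sub, C_1]
      ring

/-- The bilinear equation says that the matrix with rows `(c1, b c5 - c6)` and `(c4, c2)` has rank
at most one, while `c5` stays free. Substituting its factorization turns the quadric into
`quadricFour`. -/
theorem cone_four₁ {τ : Fin 4 → K} (h2 : (2 : K) ≠ 0) (hτ : ∀ i, τ i ≠ 0) (v : Fin 8 → K) :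
    (∀ f ∈ eqsFour₁ τ b, eval v f = 0) ↔
      ∃ w, eval w (quadricFour b) = 0 ∧ v = fun i => eval w (embed τ (paramFour₁ b) (X i)) := by
  simp only [eq_eval_embed_iff h2 hτ, forall_eqsFour₁_iff, quadricVal, forall_eq]
  generalize coordVal τ v = c
  constructor
  · rintro ⟨h0, h3, h12, hq⟩
    obtain ⟨x, y, -, hxy⟩ := exists_rank_one ![c 1, b * c 5 - c 6] ![c 4, c 2] (by
      intro i j
      fin_cases i <;> fin_cases j <;> simp
      · linear_combination h12
      · linear_combination -h12)
    obtain ⟨k, hk1, hk4⟩ : ∃ k, c 1 = x * k ∧ c 4 = y * k := hxy 0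
    obtain ⟨l, hl, hl2⟩ : ∃ l, b * c 5 - c 6 = x * l ∧ c 2 = y * l := hxy 1
    have h6 : c 6 = b * c 5 - x * l := by linear_combination -hl
    -- The halves offset the factor `2` in `embed_coord`.
    refine ⟨![c 5 / 2, x, y, k / 2, l / 2, v 3], ?_, fun i => ?_, rfl⟩
    · simp only [quadricFour, map_mul, map_sub, map_pow, eval_X, eval_C]
      simp
      rw [h0, h3, hk1, hk4, hl2, h6] at hq
      field_simp
      linear_combination -hq
    · fin_cases i <;> simp [paramFour₁, h0, h3, hk1, hk4, hl2, h6] <;> field_simp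
  · rintro ⟨w, hw, hc, -⟩
    simp only [quadricFour, map_mul, map_sub, map_pow, eval_X, eval_C] at hw
    have e0 : c 0 = 0 := by simpa [paramFour₁] using hc 0
    have e1 : c 1 = 2 * (w 1 * w 3) := by simpa [paramFour₁] using hc 1
    have e2 : c 2 = 2 * (w 2 * w 4) := by simpa [paramFour₁] using hc 2
    have e3 : c 3 = 0 := by simpa [paramFour₁] using hc 3
    have e4 : c 4 = 2 * (w 2 * w 3) := by simpa [paramFour₁] using hc 4
    have e5 : c 5 = 2 * w 0 := by simpa [paramFour₁] using hc 5
    have e6 : c 6 = 2 * (b * w 0 - w 1 * w 4) := by simpa [paramFour₁] using hc 6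
    refine ⟨e0, e3, ?_, ?_⟩ <;> rw [e1, e2, e4, e5, e6]
    · ring
    · rw [e0, e3]
      linear_combination -4 * hw

theorem cone_four₂ {τ : Fin 4 → K} (h2 : (2 : K) ≠ 0) (hτ : ∀ i, τ i ≠ 0) (v : Fin 8 → K) :
    (∀ f ∈ eqsFour₂ τ b, eval v f = 0) ↔
      ∃ w, eval w (quadricFour b) = 0 ∧ v = fun i => eval w (embed τ (paramFour₂ b) (X i)) := by
  simp only [eq_eval_embed_iff h2 hτ, forall_eqsFour₂_iff, quadricVal, forall_eq]
  generalize coordVal τ v = c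
  constructor
  · rintro ⟨h1, h4, h02, hq⟩
    obtain ⟨x, y, -, hxy⟩ := exists_rank_one ![c 0, c 5 - b * c 6] ![c 3, c 2] (by
      intro i j
      fin_cases i <;> fin_cases j <;> simp
      · linear_combination h02
      · linear_combination -h02)
    obtain ⟨k, hk0, hk3⟩ : ∃ k, c 0 = x * k ∧ c 3 = y * k := hxy 0
    obtain ⟨l, hl, hl2⟩ : ∃ l, c 5 - b * c 6 = x * l ∧ c 2 = y * l := hxy 1
    have h5 : c 5 = x * l + b * c 6 := by linear_combination hl
    refine ⟨![c 6 / 2, x, y, k / 2, l / 2, v 3], ?_, fun i => ?_, rfl⟩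
    · simp only [quadricFour, map_mul, map_sub, map_pow, eval_X, eval_C]
      simp
      rw [h1, h4, hk0, hk3, hl2, h5] at hq
      field_simp
      linear_combination -hq
    · fin_cases i <;> simp [paramFour₂, h1, h4, hk0, hk3, hl2, h5] <;> field_simp
  · rintro ⟨w, hw, hc, -⟩
    simp only [quadricFour, map_mul, map_sub, map_pow, eval_X, eval_C] at hw
    have e0 : c 0 = 2 * (w 1 * w 3) := by simpa [paramFour₂] using hc 0
    have e1 : c 1 = 0 := by simpa [paramFour₂] using hc 1
    have e2 : c 2 = 2 * (w 2 * w 4) := by simpa [paramFour₂] using hc 2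
    have e3 : c 3 = 2 * (w 2 * w 3) := by simpa [paramFour₂] using hc 3
    have e4 : c 4 = 0 := by simpa [paramFour₂] using hc 4
    have e5 : c 5 = 2 * (w 1 * w 4 + b * w 0) := by simpa [paramFour₂] using hc 5
    have e6 : c 6 = 2 * w 0 := by simpa [paramFour₂] using hc 6
    refine ⟨e1, e4, ?_, ?_⟩ <;> rw [e0, e2, e3, e5, e6]
    · ring
    · rw [e1, e4]
      linear_combination -4 * hw

/-- The first six equations are, up to factors `b`, the minors of the `2 × 4` matrix of the third
case, whose columns become multiples of a single `(x, y)`. -/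
theorem cone_eight {τ : Fin 4 → K} (h2 : (2 : K) ≠ 0) (hτ : ∀ i, τ i ≠ 0) (hb0 : b ≠ 0)
    (hb1 : b ^ 2 ≠ 1) (v : Fin 8 → K) :
    (∀ f ∈ eqsEight τ b, eval v f = 0) ↔
      ∃ w, eval w (quadricEight b) = 0 ∧ v = fun i => eval w (embed τ (paramEight b) (X i)) := by
  have hb : 1 - b ^ 2 ≠ 0 := sub_ne_zero.2 hb1.symm
  simp only [eq_eval_embed_iff h2 hτ, forall_eqsEight_iff, quadricVal, forall_eq]
  generalize coordVal τ v = c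
  constructor
  · rintro ⟨h1, h3, h4, h5, h6, h7, hq⟩
    obtain ⟨x, y, hne, hxy⟩ := exists_rank_one ![c 0, b * c 4, c 5 - b * c 6, b * c 2]
      ![c 3, c 1, c 2, b * c 5 - c 6] (by
      intro i j
      fin_cases i <;> fin_cases j <;> simp
      · linear_combination h1
      · linear_combination h3
      · linear_combination h4
      · linear_combination -h1
      · linear_combination h5
      · linear_combination -b * h6
      · linear_combination -h3
      · linear_combination -h5
      · linear_combination h7
      · linear_combination -h4
      · linear_combination b * h6
      · linear_combination -h7)
    obtain ⟨k, hk0, hk3⟩ : ∃ k, c 0 = x * k ∧ c 3 = y * k := hxy 0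
    obtain ⟨l, hl4, hl1⟩ : ∃ l, b * c 4 = x * l ∧ c 1 = y * l := hxy 1
    obtain ⟨m, hm5, hm2⟩ : ∃ m, c 5 - b * c 6 = x * m ∧ c 2 = y * m := hxy 2
    obtain ⟨n, hn2, hn5⟩ : ∃ n, b * c 2 = x * n ∧ b * c 5 - c 6 = y * n := hxy 3
    -- As `c2` occurs in both of the last two columns, `(m, n)` is proportional to `(x, b y)`; this
    -- yields the quadratic part of the scroll. The factor `1 - b²` is the determinant met on
    -- solving for `c5` and `c6`.
    obtain ⟨r, hr1, hr2⟩ : ∃ r, m = (1 - b ^ 2) * x * r ∧ n = b * (1 - b ^ 2) * y * r := by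
      have hmn : b * y * m = x * n := by rw [← hn2, hm2]; ring
      rcases hne with hx | hy
      · refine ⟨m / ((1 - b ^ 2) * x), by field_simp, ?_⟩
        field_simp
        linear_combination -hmn
      · refine ⟨n / (b * (1 - b ^ 2) * y), ?_, by field_simp⟩
        field_simp
        linear_combination hmn
    have e4 : c 4 = x * (l / b) := by field_simp; linear_combination hl4
    have e2 : c 2 = (1 - b ^ 2) * x * y * r := by rw [hm2, hr1]; ring
    have e5 : c 5 = (x ^ 2 - b ^ 2 * y ^ 2) * r := by
      refine mul_left_cancel₀ hb ?_
      rw [hr1] at hm5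
      rw [hr2] at hn5
      linear_combination hm5 - b * hn5
    have e6 : c 6 = b * (x ^ 2 - y ^ 2) * r := by
      refine mul_left_cancel₀ hb ?_
      rw [hr1] at hm5
      rw [hr2] at hn5
      linear_combination b * hm5 - hn5
    refine ⟨![k / 2, x, y, l / b / 2, r / 2, v 3], ?_, fun i => ?_, rfl⟩
    · simp only [quadricEight, map_mul, map_sub, map_add, map_pow, eval_X, eval_C]
      simp
      rw [hk0, hk3, hl1, e2, e4, e5, e6] at hq
      field_simp at hq ⊢
      linear_combination hq
    · fin_cases i <;> simp [paramEight, hk0, hk3, hl1, e2, e4, e5, e6] <;> field_simp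
  · rintro ⟨w, hw, hc, -⟩
    simp only [quadricEight, map_mul, map_sub, map_add, map_pow, eval_X, eval_C] at hw
    have e0 : c 0 = 2 * (w 1 * w 0) := by simpa [paramEight] using hc 0
    have e1 : c 1 = 2 * (b * (w 2 * w 3)) := by simpa [paramEight] using hc 1
    have e2 : c 2 = 2 * ((1 - b ^ 2) * (w 1 * w 2 * w 4)) := by simpa [paramEight] using hc 2
    have e3 : c 3 = 2 * (w 2 * w 0) := by simpa [paramEight] using hc 3
    have e4 : c 4 = 2 * (w 1 * w 3) := by simpa [paramEight] using hc 4
    have e5 : c 5 = 2 * (w 1 ^ 2 * w 4 - b ^ 2 * (w 2 ^ 2 * w 4)) := by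
      simpa [paramEight] using hc 5
    have e6 : c 6 = 2 * (b * (w 1 ^ 2 * w 4 - w 2 ^ 2 * w 4)) := by
      simpa [paramEight] using hc 6
    rw [e0, e1, e2, e3, e4, e5, e6]
    refine ⟨by ring, by ring, by ring, by ring, by ring, by ring, ?_⟩
    linear_combination 4 * hw

end param

section sections

variable {τ : Fin 4 → K} {b : K}

/-- The point with only `X₃` nonzero is a common vertex of all the cones. -/
theorem exists_ne_zero_of_coordVal_eq_zero (τ : Fin 4 → K) :
    ∃ v : Fin 8 → K, v ≠ 0 ∧ coordVal τ v = 0 := by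
  refine ⟨Pi.single 3 1, by simp, funext fun i => ?_⟩
  fin_cases i <;> simp [coordVal]

theorem isScrollSection_four₁ (h2 : (2 : K) ≠ 0) (hτ : ∀ i, τ i ≠ 0) (hb1 : b ^ 2 ≠ 1) :
    ProjVar.IsScrollSection ![0, 1, 1] (quadricFour b) (embed τ (paramFour₁ b))
      (eqsFour₁ τ b) where
  homogeneous := isHomogeneous_eqsFour₁ τ b
  span_eq := span_paramFour₁ h2 hτ
  prime := prime_quadricFour h2 hb1
  mem := quadricFour_mem b
  cone_iff := cone_four₁ h2 hτ
  nonempty := by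
    obtain ⟨v, hv, hc⟩ := exists_ne_zero_of_coordVal_eq_zero τ
    refine ⟨v, hv, (forall_eqsFour₁_iff τ b v).2 ?_⟩
    simp [hc, quadricVal]

theorem isScrollSection_four₂ (h2 : (2 : K) ≠ 0) (hτ : ∀ i, τ i ≠ 0) (hb1 : b ^ 2 ≠ 1) :
    ProjVar.IsScrollSection ![0, 1, 1] (quadricFour b) (embed τ (paramFour₂ b))
      (eqsFour₂ τ b) where
  homogeneous := isHomogeneous_eqsFour₂ τ b
  span_eq := span_paramFour₂ h2 hτ
  prime := prime_quadricFour h2 hb1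
  mem := quadricFour_mem b
  cone_iff := cone_four₂ h2 hτ
  nonempty := by
    obtain ⟨v, hv, hc⟩ := exists_ne_zero_of_coordVal_eq_zero τ
    refine ⟨v, hv, (forall_eqsFour₂_iff τ b v).2 ?_⟩
    simp [hc, quadricVal]

theorem isScrollSection_eight (h2 : (2 : K) ≠ 0) (hτ : ∀ i, τ i ≠ 0) (hb0 : b ≠ 0)
    (hb1 : b ^ 2 ≠ 1) :
    ProjVar.IsScrollSection ![1, 1, 2] (quadricEight b) (embed τ (paramEight b))
      (eqsEight τ b) where
  homogeneous := isHomogeneous_eqsEight τ b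
  span_eq := span_paramEight h2 hτ hb0 hb1
  prime := prime_quadricEight h2 hb0 hb1
  mem := quadricEight_mem b
  cone_iff := cone_eight h2 hτ hb0 hb1
  nonempty := by
    obtain ⟨v, hv, hc⟩ := exists_ne_zero_of_coordVal_eq_zero τ
    refine ⟨v, hv, (forall_eqsEight_iff τ b v).2 ?_⟩
    simp [hc, quadricVal]

end sections

end VarietyV

/-! ### Decomposition into the three components -/

namespace VarietyV

variable {K : Type*} [Field K]

section union

variable {τ : Fin 4 → K} {b : K}

theorem exists_coordVal_eq (hτ : ∀ i, τ i ≠ 0) (c : Fin 7 → K) :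
    ∃ v, coordVal τ v = fun i => 2 * c i := by
  refine ⟨![c 0 + c 2 - c 1, c 0 + c 1 - c 2, c 1 + c 2 - c 0, 0, (c 5 + c 3) / τ 0,
    (c 6 + c 4) / τ 1, (c 5 - c 3) / τ 2, (c 6 - c 4) / τ 3], funext fun i => ?_⟩
  fin_cases i <;> simp [coordVal, mul_div_cancel₀ _ (hτ _)] <;> ring

theorem ne_zero_of_coordVal_ne_zero {v : Fin 8 → K} {i : Fin 7} (h : coordVal τ v i ≠ 0) :
    v ≠ 0 := by
  rintro rfl
  refine h ?_
  fin_cases i <;> simp [coordVal]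

theorem components_union (h2 : (2 : K) ≠ 0) (hτ : ∀ i, τ i ≠ 0) (hb0 : b ≠ 0)
    (hb1 : b ^ 2 ≠ 1) [IsAlgClosed K] :
    ProjVar.components (ProjVar.zeroLocus (eqsFour₁ τ b) ∪ ProjVar.zeroLocus (eqsFour₂ τ b) ∪
      ProjVar.zeroLocus (eqsEight τ b)) = {ProjVar.zeroLocus (eqsFour₁ τ b),
        ProjVar.zeroLocus (eqsFour₂ τ b), ProjVar.zeroLocus (eqsEight τ b)} ∧
      ProjVar.zeroLocus (eqsFour₁ τ b) ≠ ProjVar.zeroLocus (eqsFour₂ τ b) := by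
  have H1 := isHomogeneous_eqsFour₁ τ b
  have H2 := isHomogeneous_eqsFour₂ τ b
  have H8 := isHomogeneous_eqsEight τ b
  -- Of the three loci, `v₁` lies only on the first and `v₂` only on the second; `v₃` and `v₄` lie
  -- on the third, off the first and off the second respectively.
  obtain ⟨v₁, hv₁⟩ := exists_coordVal_eq hτ ![0, 1, 0, 0, 0, 0, -1]
  obtain ⟨v₂, hv₂⟩ := exists_coordVal_eq hτ ![1, 0, 0, 0, 0, 1, 0]
  obtain ⟨v₃, hv₃⟩ := exists_coordVal_eq hτ ![1, 0, 0, 1, 0, 0, 0]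
  obtain ⟨v₄, hv₄⟩ := exists_coordVal_eq hτ ![0, 1, 0, 0, 1, 0, 0]
  have n₁ : v₁ ≠ 0 := ne_zero_of_coordVal_ne_zero (τ := τ) (i := 1) (by simp [hv₁, h2])
  have n₂ : v₂ ≠ 0 := ne_zero_of_coordVal_ne_zero (τ := τ) (i := 0) (by simp [hv₂, h2])
  have n₃ : v₃ ≠ 0 := ne_zero_of_coordVal_ne_zero (τ := τ) (i := 0) (by simp [hv₃, h2])
  have n₄ : v₄ ≠ 0 := ne_zero_of_coordVal_ne_zero (τ := τ) (i := 1) (by simp [hv₄, h2])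
  have h12 : ¬ ProjVar.zeroLocus (eqsFour₁ τ b) ⊆ ProjVar.zeroLocus (eqsFour₂ τ b) := by
    refine ProjVar.not_zeroLocus_subset H1 H2 n₁ ?_ ?_
    · rw [forall_eqsFour₁_iff]
      simp [hv₁, quadricVal]
    · rw [forall_eqsFour₂_iff]
      simp [hv₁, h2]
  refine ⟨ProjVar.components_union_three (isScrollSection_four₁ h2 hτ hb1).isIrreducible
    (isScrollSection_four₂ h2 hτ hb1).isIrreducible
    (isScrollSection_eight h2 hτ hb0 hb1).isIrreducible (ProjVar.isClosed_zeroLocus H1)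
    (ProjVar.isClosed_zeroLocus H2) (ProjVar.isClosed_zeroLocus H8) h12
    (ProjVar.not_zeroLocus_subset H1 H8 n₁ ?_ ?_) (ProjVar.not_zeroLocus_subset H2 H1 n₂ ?_ ?_)
    (ProjVar.not_zeroLocus_subset H2 H8 n₂ ?_ ?_) (ProjVar.not_zeroLocus_subset H8 H1 n₃ ?_ ?_)
    (ProjVar.not_zeroLocus_subset H8 H2 n₄ ?_ ?_), fun h => h12 h.subset⟩
  · rw [forall_eqsFour₁_iff]
    simp [hv₁, quadricVal]
  · rw [forall_eqsEight_iff]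
    simp [hv₁, h2, hb0]
  · rw [forall_eqsFour₂_iff]
    simp [hv₂, quadricVal]
  · rw [forall_eqsFour₁_iff]
    simp [hv₂, h2]
  · rw [forall_eqsFour₂_iff]
    simp [hv₂, quadricVal]
  · rw [forall_eqsEight_iff]
    simp [hv₂, h2, hb0]
  · rw [forall_eqsEight_iff]
    simp [hv₃, quadricVal]
  · rw [forall_eqsFour₁_iff]
    simp [hv₃, h2]
  · rw [forall_eqsEight_iff]
    simp [hv₄, quadricVal]
  · rw [forall_eqsFour₂_iff]
    simp [hv₄, h2]

/-- The bilinear equations are the minors on columns `1,2`, `1,3` and (up to the factor `b`) `2,4`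
of the `2 × 4` matrix. If columns `1` and `2` are both nonzero, they are proportional and the other
two columns are multiples of them, so all minors vanish. -/
theorem forall_eqs_iff (hb0 : b ≠ 0) (v : Fin 8 → K) :
    ((∀ f ∈ eqsFour₁ τ b, eval v f = 0) ∨ (∀ f ∈ eqsFour₂ τ b, eval v f = 0) ∨
      (∀ f ∈ eqsEight τ b, eval v f = 0)) ↔ ∀ c, c = coordVal τ v →
      c 0 * c 1 - b * (c 3 * c 4) = 0 ∧ c 0 * c 2 - c 3 * (c 5 - b * c 6) = 0 ∧
      c 1 * c 2 - c 4 * (b * c 5 - c 6) = 0 ∧ quadricVal b c = 0 := by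
  simp only [forall_eqsFour₁_iff, forall_eqsFour₂_iff, forall_eqsEight_iff, forall_eq]
  generalize coordVal τ v = c
  constructor
  · rintro (⟨h0, h3, h12, hq⟩ | ⟨h1, h4, h02, hq⟩ | ⟨h1, h3, -, -, h6, -, hq⟩)
    · exact ⟨by rw [h0, h3]; ring, by rw [h0, h3]; ring, h12, hq⟩
    · exact ⟨by rw [h1, h4]; ring, h02, by rw [h1, h4]; ring, hq⟩
    · exact ⟨h1, h3, h6, hq⟩
  · rintro ⟨h01, h02, h12, hq⟩
    by_cases hA : c 0 = 0 ∧ c 3 = 0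
    · exact Or.inl ⟨hA.1, hA.2, h12, hq⟩
    by_cases hB : c 1 = 0 ∧ c 4 = 0
    · exact Or.inr (Or.inl ⟨hB.1, hB.2, h02, hq⟩)
    refine Or.inr (Or.inr ?_)
    have hB' : c 1 ≠ 0 ∨ c 4 ≠ 0 := by tauto
    have key : ∀ x y : K, (c 0 * y = c 3 * x) → ∃ k, x = c 0 * k ∧ y = c 3 * k := by
      intro x y hxy
      by_cases h0 : c 0 = 0
      · have h3 : c 3 ≠ 0 := fun h => hA ⟨h0, h⟩
        refine ⟨y / c 3, ?_, by field_simp⟩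
        field_simp
        linear_combination -hxy
      · refine ⟨x / c 0, by field_simp, ?_⟩
        field_simp
        linear_combination hxy
    obtain ⟨k, hk4, hk1⟩ := key (b * c 4) (c 1) (by linear_combination h01)
    obtain ⟨l, hl, hl2⟩ := key (c 5 - b * c 6) (c 2) (by linear_combination h02)
    have hk0 : k ≠ 0 := by
      rintro rfl
      simp only [mul_zero, mul_eq_zero, hb0, false_or] at hk4 hk1
      tauto
    -- Column `2` is `k` times column `1` with `k ≠ 0`, so the minor on columns `2,4` gives the one
    -- on columns `1,4`.
    have h03 : c 0 * (b * c 5 - c 6) - b * (c 2 * c 3) = 0 := by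
      refine (mul_eq_zero.1 (?_ : k * _ = 0)).resolve_left hk0
      linear_combination -b * h12 - (b * c 5 - c 6) * hk4 + b * c 2 * hk1
    obtain ⟨m, hm2, hm⟩ := key (b * c 2) (b * c 5 - c 6) (by linear_combination h03)
    refine ⟨h01, h02, h03, ?_, h12, ?_, hq⟩
    · linear_combination c 2 * hk4 - (c 5 - b * c 6) * hk1 + c 0 * k * hl2 - c 3 * k * hl
    · linear_combination (b * c 5 - c 6) * hl + c 0 * l * hm - c 2 * hm2 - c 0 * m * hl2

end union

end VarietyV

/-! ### The variety as a union of scroll sections -/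

namespace VarietyV

variable {K : Type*} [Field K]

theorem isHomogeneous_sq_sub {σ : Type*} {f : MvPolynomial σ K} (hf : f.IsHomogeneous 1)
    (i j : σ) (x y z : K) :
    (f ^ 2 - (C x * X i ^ 2 + C y * X j ^ 2 - C z * X i * X j)).IsHomogeneous 2 := by
  have hX := isHomogeneous_X (σ := σ) K
  have h := ((isHomogeneous_C_mul ((hX i).pow 2) x).add
    (isHomogeneous_C_mul ((hX j).pow 2) y)).sub (isHomogeneous_C_mul ((hX i).mul (hX j)) z)
  rw [← mul_assoc] at h
  exact (hf.pow 2).sub h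

/-- After rescaling the `Y i` by `τ`, twice each bilinear relation is a signed sum of the four
equations and the quadric is twice their sum. The inverse combinations recover four times each
equation, so `2 ≠ 0` suffices. -/
theorem varietyV_eq_union {q : ℕ} {β η b : K} {τ : Fin 4 → K} (h2 : (2 : K) ≠ 0) (hb0 : b ≠ 0)
    (h0 : η = τ 0 ^ 2) (h1 : η ^ q = τ 1 ^ 2) (h2' : η ^ q ^ 2 = τ 2 ^ 2)
    (h3 : η ^ q ^ 3 = τ 3 ^ 2) (h01 : β * η ^ ((q + 1) / 2) = b * (τ 0 * τ 1))
    (h12 : β ^ q * η ^ ((q ^ 2 + q) / 2) = b * (τ 1 * τ 2))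
    (h23 : β ^ q ^ 2 * η ^ ((q ^ 3 + q ^ 2) / 2) = b * (τ 2 * τ 3))
    (h30 : β ^ q ^ 3 * η ^ ((1 + q ^ 3) / 2) = b * (τ 3 * τ 0)) :
    varietyV q β η = ProjVar.zeroLocus (eqsFour₁ τ b) ∪ ProjVar.zeroLocus (eqsFour₂ τ b) ∪
      ProjVar.zeroLocus (eqsEight τ b) := by
  have hX := isHomogeneous_X (σ := Fin 8) K
  ext P
  induction P using Projectivization.ind with
  | h v hv =>
  rw [Set.mem_union, Set.mem_union, ProjVar.mk_mem_zeroLocus_iff (isHomogeneous_eqsFour₁ τ b),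
    ProjVar.mk_mem_zeroLocus_iff (isHomogeneous_eqsFour₂ τ b),
    ProjVar.mk_mem_zeroLocus_iff (isHomogeneous_eqsEight τ b), or_assoc, forall_eqs_iff hb0,
    varietyV, ProjVar.mk_mem_zeroLocus_iff]
  · simp only [Set.mem_insert_iff, Set.mem_singleton_iff, forall_eq_or_imp, forall_eq, map_sub,
      map_add, map_mul, map_pow, eval_X, eval_C, mul_assoc, map_ofNat, quadricVal, coordVal]
    simp only [Matrix.cons_val]
    constructor
    · rintro ⟨a1, a2, a3, a4⟩
      have e1 : v 0 ^ 2 - (τ 0 ^ 2 * v 4 ^ 2 + τ 1 ^ 2 * v 5 ^ 2 -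
          2 * b * (τ 0 * τ 1) * v 4 * v 5) = 0 := by
        linear_combination a1 + v 4 ^ 2 * h0 + v 5 ^ 2 * h1 - 2 * v 4 * v 5 * h01
      have e2 : v 1 ^ 2 - (τ 1 ^ 2 * v 5 ^ 2 + τ 2 ^ 2 * v 6 ^ 2 -
          2 * b * (τ 1 * τ 2) * v 5 * v 6) = 0 := by
        linear_combination a2 + v 5 ^ 2 * h1 + v 6 ^ 2 * h2' - 2 * v 5 * v 6 * h12
      have e3 : v 2 ^ 2 - (τ 2 ^ 2 * v 6 ^ 2 + τ 3 ^ 2 * v 7 ^ 2 -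
          2 * b * (τ 2 * τ 3) * v 6 * v 7) = 0 := by
        linear_combination a3 + v 6 ^ 2 * h2' + v 7 ^ 2 * h3 - 2 * v 6 * v 7 * h23
      have e4 : (v 0 + v 1 + v 2) ^ 2 - (τ 3 ^ 2 * v 7 ^ 2 + τ 0 ^ 2 * v 4 ^ 2 -
          2 * b * (τ 3 * τ 0) * v 7 * v 4) = 0 := by
        linear_combination a4 + v 7 ^ 2 * h3 + v 4 ^ 2 * h0 - 2 * v 7 * v 4 * h30
      refine ⟨mul_left_cancel₀ h2 ?_, mul_left_cancel₀ h2 ?_, mul_left_cancel₀ h2 ?_,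
        mul_left_cancel₀ h2 ?_⟩
      · linear_combination e4 - e1 + e2 - e3
      · linear_combination e1 - e2 + e4 - e3
      · linear_combination e4 - e1 - e2 + e3
      · linear_combination 2 * (e1 + e2 + e3 + e4)
    · rintro ⟨b1, b2, b3, bq⟩
      have h4 : (4 : K) ≠ 0 := by
        rw [show (4 : K) = 2 * 2 by norm_num]
        exact mul_ne_zero h2 h2
      refine ⟨mul_left_cancel₀ h4 ?_, mul_left_cancel₀ h4 ?_, mul_left_cancel₀ h4 ?_,
        mul_left_cancel₀ h4 ?_⟩
      · linear_combination bq + 2 * b2 - 2 * b1 - 2 * b3 -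
          4 * (v 4 ^ 2 * h0 + v 5 ^ 2 * h1 - 2 * v 4 * v 5 * h01)
      · linear_combination bq - 2 * b2 + 2 * b1 - 2 * b3 -
          4 * (v 5 ^ 2 * h1 + v 6 ^ 2 * h2' - 2 * v 5 * v 6 * h12)
      · linear_combination bq - 2 * b2 - 2 * b1 + 2 * b3 -
          4 * (v 6 ^ 2 * h2' + v 7 ^ 2 * h3 - 2 * v 6 * v 7 * h23)
      · linear_combination bq + 2 * b2 + 2 * b1 + 2 * b3 -
          4 * (v 7 ^ 2 * h3 + v 4 ^ 2 * h0 - 2 * v 7 * v 4 * h30)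
  · rintro f (rfl | rfl | rfl | rfl)
    exacts [⟨2, isHomogeneous_sq_sub (hX 0) 4 5 _ _ _⟩, ⟨2, isHomogeneous_sq_sub (hX 1) 5 6 _ _ _⟩,
      ⟨2, isHomogeneous_sq_sub (hX 2) 6 7 _ _ _⟩,
      ⟨2, isHomogeneous_sq_sub (((hX 0).add (hX 1)).add (hX 2)) 7 4 _ _ _⟩]

end VarietyV

/-! ### The main theorem -/

theorem mainTheorem4 (q : ℕ) (hq : IsPrimePow q) (hodd : Odd q)
    (F : Type*) [Field F] [Fintype F] (hF : Fintype.card F = q ^ 4)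
    (K : Type*) [Field K] [Algebra F K] [IsAlgClosure F K]
    (β : F) (hβ0 : β ≠ 0) (hβ1 : β ≠ 1) (hβ2 : β ≠ -1) (hβ : β ^ (2 * q) = β ^ 2) :
    ∃ η : F, ¬ IsSquare η ∧
      let V : Set (ℙ K (Fin 8 → K)) := varietyV q (algebraMap F K β) (algebraMap F K η)
      {Z ∈ ProjVar.components V | ProjVar.HasDim Z 3}.ncard = 3 ∧
      {Z ∈ ProjVar.components V | ProjVar.HasDim Z 3 ∧ ProjVar.HasDegree Z 4}.ncard = 2 ∧
      ∃! V' : Set (ℙ K (Fin 8 → K)),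
        V' ∈ ProjVar.components V ∧ ProjVar.HasDim V' 3 ∧ ProjVar.HasDegree V' 8 := by
  have := IsAlgClosure.isAlgClosed F (K := K)
  have h2F : (2 : F) ≠ 0 := by
    intro h
    have h1 := Nat.cast_card_eq_zero F
    rw [hF] at h1
    obtain ⟨k, hk⟩ := hodd.pow (n := 4)
    rw [hk] at h1
    push_cast at h1
    rw [h] at h1
    simp at h1
  have h2 : (2 : K) ≠ 0 := by
    rw [← map_ofNat (algebraMap F K) 2]
    exact (map_ne_zero _).2 h2F
  obtain ⟨η, hη⟩ := FiniteField.exists_nonsquare (F := F) fun h => h2F (by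
    have := CharP.cast_eq_zero F (ringChar F)
    rw [h] at this
    exact_mod_cast this)
  refine ⟨η, hη, ?_⟩
  have hη0 : algebraMap F K η ≠ 0 := (map_ne_zero _).2 fun h => hη (h ▸ IsSquare.zero)
  set b := algebraMap F K β with hb
  have hb0 : b ≠ 0 := (map_ne_zero _).2 hβ0
  have hb1 : b ^ 2 ≠ 1 := by
    rw [hb, ← map_pow, ← map_one (algebraMap F K)]
    refine fun h => ?_
    rcases sq_eq_sq_iff_eq_or_eq_neg.1
      (((algebraMap F K).injective h).trans (one_pow 2).symm) with h | h
    · exact hβ1 h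
    · exact hβ2 h
  -- The hypothesis on `β` says `(b^q)² = b²`; as `q` is odd, the sign satisfies `ε^q = ε`.
  obtain ⟨ε, hε, hεq, hbq⟩ : ∃ ε : K, ε ^ 2 = 1 ∧ ε ^ q = ε ∧ b ^ q = ε * b := by
    have h : (b ^ q) ^ 2 = b ^ 2 := by
      rw [hb, ← pow_mul, mul_comm q 2, ← map_pow, hβ, map_pow]
    rcases sq_eq_sq_iff_eq_or_eq_neg.1 h with h | h
    · exact ⟨1, by simp, by simp, by simpa using h⟩
    · exact ⟨-1, by simp, hodd.neg_one_pow, by simpa using h⟩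
  have hbq2 : b ^ q ^ 2 = b := by
    rw [pow_two, pow_mul, hbq, mul_pow, hεq, hbq]
    linear_combination b * hε
  have hbq3 : b ^ q ^ 3 = ε * b := by rw [pow_succ, pow_mul, hbq2, hbq]
  obtain ⟨r, hr⟩ := IsAlgClosed.exists_pow_nat_eq (algebraMap F K η) two_pos
  have hr0 : r ≠ 0 := by
    rintro rfl
    exact hη0 (by rw [← hr]; simp)
  have hε0 : ε ≠ 0 := by
    rintro rfl
    simp at hε
  have hsq : ∀ n, algebraMap F K η ^ n = (r ^ n) ^ 2 := fun n => by
    rw [← hr, ← pow_mul, ← pow_mul, mul_comm]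
  have hhalf : ∀ m n, Odd m → Odd n → algebraMap F K η ^ ((m + n) / 2) = r ^ m * r ^ n := by
    intro m n hm hn
    rw [← hr, ← pow_mul, Nat.mul_div_cancel' (hm.add_odd hn).two_dvd, pow_add]
  -- The signs of `τ 0 τ 1`, `τ 1 τ 2`, `τ 2 τ 3`, `τ 3 τ 0` are `1, ε, ε² = 1, ε`, matching `b,
  -- b^q, b^(q²), b^(q³)`.
  set τ : Fin 4 → K := ![r, r ^ q, ε * r ^ q ^ 2, ε * r ^ q ^ 3] with hτdef
  have hτ : ∀ i, τ i ≠ 0 := by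
    intro i
    fin_cases i <;> simp [hτdef, hr0, hε0]
  have hV := VarietyV.varietyV_eq_union (q := q) (β := b) (η := algebraMap F K η) (τ := τ)
    h2 hb0 hr.symm (hsq q) ((hsq _).trans ?_) ((hsq _).trans ?_) ?_ ?_ ?_ ?_
  · obtain ⟨hcomp, hne12⟩ := VarietyV.components_union h2 hτ hb0 hb1
    have s1 := VarietyV.isScrollSection_four₁ h2 hτ hb1
    have s2 := VarietyV.isScrollSection_four₂ h2 hτ hb1
    have s8 := VarietyV.isScrollSection_eight h2 hτ hb0 hb1
    have d1 := s1.hasDim_three_of_quadricFour hb1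
    have d2 := s2.hasDim_three_of_quadricFour hb1
    have d8 := s8.hasDim_three_of_quadricEight hb1
    have g1 : ProjVar.HasDegree _ 4 := s1.hasDegree d1 (by simp)
    have g2 : ProjVar.HasDegree _ 4 := s2.hasDegree d2 (by simp)
    have g8 : ProjVar.HasDegree _ 8 := s8.hasDegree d8 (by simp)
    simp only [hV, hcomp]
    generalize ProjVar.zeroLocus (VarietyV.eqsFour₁ τ b) = Z₁ at *
    generalize ProjVar.zeroLocus (VarietyV.eqsFour₂ τ b) = Z₂ at *
    generalize ProjVar.zeroLocus (VarietyV.eqsEight τ b) = Z₈ at *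
    have n48 : ∀ Z : Set (ℙ K (Fin 8 → K)), ProjVar.HasDegree Z 4 → ¬ ProjVar.HasDegree Z 8 :=
      fun Z h4 h8 => by simpa using h4.unique h8
    have hne18 : Z₁ ≠ Z₈ := fun h => n48 _ g1 (h ▸ g8)
    have hne28 : Z₂ ≠ Z₈ := fun h => n48 _ g2 (h ▸ g8)
    refine ⟨?_, ?_, Z₈, ⟨by simp, d8, g8⟩, ?_⟩
    · rw [Set.ncard_eq_three]
      refine ⟨Z₁, Z₂, Z₈, hne12, hne18, hne28, Set.sep_eq_self_iff_mem_true.2 ?_⟩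
      rintro Z (rfl | rfl | rfl) <;> assumption
    · rw [Set.ncard_eq_two]
      refine ⟨Z₁, Z₂, hne12, Set.ext fun Z => ⟨?_, ?_⟩⟩
      · rintro ⟨rfl | rfl | rfl, -, h⟩
        exacts [Or.inl rfl, Or.inr rfl, (n48 _ h g8).elim]
      · rintro (rfl | rfl)
        exacts [⟨Or.inl rfl, d1, g1⟩, ⟨Or.inr (Or.inl rfl), d2, g2⟩]
    · rintro Z ⟨rfl | rfl | rfl, -, h⟩
      exacts [(n48 _ g1 h).elim, (n48 _ g2 h).elim, rfl]
  · change (r ^ q ^ 2) ^ 2 = (ε * r ^ q ^ 2) ^ 2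
    rw [mul_pow, hε, one_mul]
  · change (r ^ q ^ 3) ^ 2 = (ε * r ^ q ^ 3) ^ 2
    rw [mul_pow, hε, one_mul]
  · rw [hhalf _ _ hodd odd_one]
    change b * (r ^ q * r ^ 1) = b * (r * r ^ q)
    ring
  · rw [hhalf _ _ hodd.pow hodd, hbq]
    change ε * b * (r ^ q ^ 2 * r ^ q) = b * (r ^ q * (ε * r ^ q ^ 2))
    ring
  · rw [hhalf _ _ hodd.pow hodd.pow, hbq2]
    change b * (r ^ q ^ 3 * r ^ q ^ 2) = b * (ε * r ^ q ^ 2 * (ε * r ^ q ^ 3))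
    linear_combination -b * r ^ q ^ 3 * r ^ q ^ 2 * hε
  · rw [hhalf _ _ odd_one hodd.pow, hbq3]
    change ε * b * (r ^ 1 * r ^ q ^ 3) = b * (ε * r ^ q ^ 3 * r)
    ring
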